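/- Let $G$ be any group. A $G$-tree is a simplicial tree with a simplicial action of $G$ that does not invert any edge. A splitting of $G$ is a $G$-tree $S$ without a global fixed point such that the quotient graph $G\backslash S$ has exactly one edge; two splittings are isomorphic if there is a $G$-equivariant isomorphism between their trees. A compatibility tree for a family $\{\sigma_j \mid j\in J\}$ of splittings of $G$ is a $G$-tree $T$ together with a bijection between $J$ and the set of $G$-orbits of edges of $T$ such that, for each $j\in J$, collapsing all edges of $T$ outside the orbit corresponding to $j$ yields a $G$-tree that is $G$-equivariantly isomorphic to the tree of $\sigma_j$. The family is compatible if it has a compatibility tree. Let $\{\sigma_j \mid j\in J\}$ be a finite compatible family of splittings of $G$, where $\sigma_j$ and $\sigma_k$ are allowed to be isomorphic for $j\neq k$, and let $T$ and $T'$ be compatibility trees for it. Then there exists a $G$-equivariant isomorphism from $T$ to $T'$. -/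

import Mathlib

universe u v w w'

/-- A `G`-graph: a simple graph with an action of the group `G` by graph automorphisms. -/
structure GGraph (G : Type u) [Group G] where
  /-- the vertices -/
  V : Type v
  /-- the action of `G` on the vertices -/
  action : MulAction G V
  /-- the underlying graph -/
  graph : SimpleGraph V
  /-- the action is simplicial (applied to `g⁻¹`, this shows that each `g` is an automorphism) -/
  smul_adj : ∀ (g : G) {a b : V}, graph.Adj a b → graph.Adj (g • a) (g • b)

attribute [instance] GGraph.action

namespace GGraph

variable {G : Type u} [Group G]

/-- The existence of a `G`-equivariant isomorphism between two `G`-graphs. -/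
def IsIsomorphic (X : GGraph.{u, v} G) (Y : GGraph.{u, w} G) : Prop :=
  ∃ f : X.graph ≃g Y.graph, ∀ (g : G) (a : X.V), f (g • a) = g • f a

/-- A `G`-tree: a simplicial tree with a simplicial `G`-action that does not invert any edge. -/
structure IsGTree (X : GGraph.{u, v} G) : Prop where
  isTree : X.graph.IsTree
  no_inversion : ∀ (g : G) (a b : X.V), X.graph.Adj a b → ¬ (g • a = b ∧ g • b = a)

/-- The image of an undirected edge (an unordered pair of vertices) under `g`. -/
def moveEdge (X : GGraph.{u, v} G) (g : G) (e : Sym2 X.V) : Sym2 X.V :=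
  e.map (fun a => g • a)

/-- The set of `G`-orbits of (undirected) edges, i.e. the set of edges of the quotient graph. -/
def edgeOrbits (X : GGraph.{u, v} G) : Set (Set (Sym2 X.V)) :=
  {O | ∃ e ∈ X.graph.edgeSet, O = {f | ∃ g : G, X.moveEdge g e = f}}

/-- A splitting of `G`: a `G`-tree without a global fixed point whose quotient graph has exactly
one edge. (As edges are not inverted, a point of the geometric realization can be fixed by `G`
only if a vertex is.) -/
structure IsSplitting (X : GGraph.{u, v} G) : Prop where
  isGTree : X.IsGTree
  no_fixed_point : ¬ ∃ a : X.V, ∀ g : G, g • a = a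
  one_edge_orbit : ∃ O, X.edgeOrbits = {O}

theorem moveEdge_mul (X : GGraph.{u, v} G) (g h : G) (e : Sym2 X.V) :
    X.moveEdge (g * h) e = X.moveEdge g (X.moveEdge h e) := by
  simp only [moveEdge, Sym2.map_map]
  congr 1
  funext a
  exact mul_smul g h a

theorem moveEdge_one (X : GGraph.{u, v} G) (e : Sym2 X.V) : X.moveEdge 1 e = e := by
  simp [moveEdge]

theorem moveEdge_mem (X : GGraph.{u, v} G) (O : X.edgeOrbits) (g : G) {e : Sym2 X.V}
    (he : X.moveEdge g e ∈ O.1) : e ∈ O.1 := by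
  obtain ⟨e₀, -, hO⟩ := O.2
  rw [hO] at he ⊢
  obtain ⟨h, hh⟩ := he
  refine ⟨g⁻¹ * h, ?_⟩
  rw [moveEdge_mul, hh, ← moveEdge_mul, inv_mul_cancel, moveEdge_one]

/-- The subgraph consisting of all vertices and of the edges to be collapsed, namely those
outside the orbit `O`. -/
def collapsed (X : GGraph.{u, v} G) (O : X.edgeOrbits) : SimpleGraph X.V :=
  X.graph.deleteEdges O.1

/-- The action of one group element on the collapsed subgraph. -/
def collapsedHom (X : GGraph.{u, v} G) (O : X.edgeOrbits) (g : G) :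
    X.collapsed O →g X.collapsed O where
  toFun a := g • a
  map_rel' {a b} h := by
    simp only [collapsed, SimpleGraph.deleteEdges_adj] at h ⊢
    exact ⟨X.smul_adj g h.1, fun hO => h.2 (X.moveEdge_mem O g hO)⟩

/-- The group acts on the connected components of the collapsed subgraph. -/
instance collapsedAction (X : GGraph.{u, v} G) (O : X.edgeOrbits) :
    MulAction G (X.collapsed O).ConnectedComponent where
  smul g C := C.map (X.collapsedHom O g)
  one_smul C := by
    induction C using SimpleGraph.ConnectedComponent.ind with
    | h a => exact congrArg _ (one_smul G a)
  mul_smul g h C := by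
    induction C using SimpleGraph.ConnectedComponent.ind with
    | h a => exact congrArg _ (mul_smul g h a)

/-- The `G`-graph obtained from a `G`-tree by collapsing all edges except those of the orbit `O`:
each connected component of the union of the other edges becomes one vertex, and the edges in `O`
remain. (In a tree, an edge of `O` joins two different components, and two components are joined
by at most one edge, so that no loops or multiple edges can arise.) -/
def collapseAllExcept (X : GGraph.{u, v} G) (O : X.edgeOrbits) : GGraph.{u, v} G where
  V := (X.collapsed O).ConnectedComponent
  action := X.collapsedAction O
  graph :=
    { Adj := fun C D => C ≠ D ∧ ∃ a b : X.V, X.graph.Adj a b ∧ s(a, b) ∈ O.1 ∧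
        (X.collapsed O).connectedComponentMk a = C ∧ (X.collapsed O).connectedComponentMk b = D
      symm := ⟨by
        rintro C D ⟨hne, a, b, hab, hO, ha, hb⟩
        exact ⟨hne.symm, b, a, hab.symm, by rwa [Sym2.eq_swap], hb, ha⟩⟩
      loopless := ⟨fun C h => h.1 rfl⟩ }
  smul_adj := by
    rintro g C D ⟨hne, a, b, hab, hO, rfl, rfl⟩
    refine ⟨fun h => hne (MulAction.injective g h), g • a, g • b, X.smul_adj g hab, ?_, rfl, rfl⟩
    refine X.moveEdge_mem O g⁻¹ ?_
    simpa [moveEdge] using hO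

/-- `T` is a compatibility tree for the family `σ`: a `G`-tree with a bijection between the index
set and the set of edge orbits, such that collapsing all edges except those in the orbit of index
`j` yields a tree for `σ j`. -/
def IsCompatibilityTree {J : Type w} (T : GGraph.{u, v} G) (σ : J → GGraph.{u, w'} G) : Prop :=
  T.IsGTree ∧ ∃ φ : J ≃ T.edgeOrbits, ∀ j, (T.collapseAllExcept (φ j)).IsIsomorphic (σ j)

end GGraph

/-! A tree with an edge can be rebuilt from its oriented edges, ordered by inclusion of half-trees
(`isIsomorphic_of_orderIso`). The oriented edges of a compatibility tree form the disjoint union of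
those of the trees `σ j`, with the same order inside each orbit
(`IsCompatibilityTree.exists_equiv`). So `T` and `T'` give an equivariant bijection `Θ` of pocsets
that can spoil the order only between different orbits.

As splittings have no fixed point, every edge is translated along an axis by some group element.
This leaves little freedom: if `e ≤ f` but not `Θ e ≤ Θ f`, then `Θ f ≤ Θ e`, and `e`, `f` are
crossed by the axes of the same elements (`coaxial_of_conflict`). A class of coaxial edges is a
convex chain from which nothing branches off (`not_branch`, `of_le_of_le`), so an edge that is
comparable to one member without being coaxial to it compares alike with all members
(`lt_of_lt_left`).

Hence only the order inside the classes needs repair: it suffices to send each class monotonically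
and equivariantly onto the class of its image (`exists_orderIso`). If an element that keeps an edge
in its class always fixes that edge, cofiniteness makes the classes finite, and rank does the job.
Otherwise the tree is a line; translation numbers agree on both sides, and a reflection, if there is
one, aligns the centres (`exists_orderIso_of_line`). -/

/-! ### Tree pocsets and translations -/

/-- A pocset satisfying the axioms of the oriented edges of a simplicial tree, ordered by inclusion
of half-trees, where `-a` is the edge `a` with the opposite orientation. -/
class TreePocset (A : Type*) [PartialOrder A] [InvolutiveNeg A] : Prop where
  neg_le_neg : ∀ {a b : A}, a ≤ b → -b ≤ -a
  not_le_neg : ∀ {a b : A}, a ≤ b → ¬ a ≤ -b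
  nested : ∀ a b : A, a ≤ b ∨ a ≤ -b ∨ -a ≤ b ∨ b ≤ a
  finite_Icc : ∀ a b : A, (Set.Icc a b).Finite

/-- An action on a tree pocset which does not invert any edge. -/
class TreePocsetAction (G A : Type*) [Group G] [MulAction G A] [PartialOrder A]
    [InvolutiveNeg A] : Prop where
  smul_le_smul : ∀ (g : G) {a b : A}, a ≤ b → g • a ≤ g • b
  smul_neg_eq : ∀ (g : G) (a : A), g • (-a) = -(g • a)
  smul_ne_neg : ∀ (g : G) (a : A), g • a ≠ -a

/-- Two oriented edges are coaxial if they are crossed in the positive direction by the axes of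
the same group elements. -/
def Coaxial (G : Type*) {A : Type*} [Group G] [MulAction G A] [PartialOrder A] (a b : A) : Prop :=
  ∀ g : G, g • a < a ↔ g • b < b

namespace TreePocset

section Order

variable {A : Type*} [PartialOrder A] [InvolutiveNeg A] [TreePocset A] {a b c : A}

theorem neg_le_neg_iff_le : -a ≤ -b ↔ b ≤ a :=
  ⟨fun h => by simpa using neg_le_neg h, neg_le_neg⟩

theorem neg_lt_neg_iff_lt : -a < -b ↔ b < a := by
  simp only [lt_iff_le_not_ge, neg_le_neg_iff_le]

theorem neg_le_comm : -a ≤ b ↔ -b ≤ a := by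
  rw [← neg_le_neg_iff_le, neg_neg]

theorem le_neg_comm : a ≤ -b ↔ b ≤ -a := by
  rw [← neg_le_neg_iff_le, neg_neg]

theorem lt_neg_comm : a < -b ↔ b < -a := by
  rw [← neg_lt_neg_iff_lt, neg_neg]

theorem not_neg_le (h : a ≤ b) : ¬ -a ≤ b := fun h' =>
  not_le_neg (neg_le_comm.1 h') (neg_le_neg h)

theorem le_or_le (h₁ : ¬ a ≤ -b) (h₂ : ¬ -a ≤ b) : a ≤ b ∨ b ≤ a := by
  rcases nested a b with h | h | h | h <;> tauto

end Order

section Action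

variable {G A : Type*} [Group G] [MulAction G A] [PartialOrder A] [InvolutiveNeg A]
  [TreePocsetAction G A] {a b c e f y : A} {g k : G}

open TreePocsetAction

theorem smul_le_smul_iff (g : G) : g • a ≤ g • b ↔ a ≤ b :=
  ⟨fun h => by simpa using smul_le_smul g⁻¹ h, smul_le_smul g⟩

theorem smul_lt_smul_iff (g : G) : g • a < g • b ↔ a < b := by
  simp only [lt_iff_le_not_ge, smul_le_smul_iff]

theorem smul_le_iff : g • a ≤ b ↔ a ≤ g⁻¹ • b := by
  rw [← smul_le_smul_iff g⁻¹, inv_smul_smul]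

theorem smul_lt_iff : g • a < b ↔ a < g⁻¹ • b := by
  rw [← smul_lt_smul_iff g⁻¹, inv_smul_smul]

theorem le_smul_iff : a ≤ g • b ↔ g⁻¹ • a ≤ b := by
  rw [← smul_le_smul_iff g⁻¹, inv_smul_smul]

theorem lt_smul_iff : a < g • b ↔ g⁻¹ • a < b := by
  rw [← smul_lt_smul_iff g⁻¹, inv_smul_smul]

theorem pow_smul_strictAnti (h : g • a < a) : StrictAnti fun n : ℕ => g ^ n • a :=
  strictAnti_nat_of_succ_lt fun n => by
    rw [pow_succ, mul_smul]
    exact (smul_lt_smul_iff _).2 h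

theorem pow_smul_antitone (h : g • a ≤ a) : Antitone fun n : ℕ => g ^ n • a :=
  antitone_nat_of_succ_le fun n => by
    rw [pow_succ, mul_smul]
    exact (smul_le_smul_iff _).2 h

theorem pow_smul_le (h : g • a ≤ a) (n : ℕ) : g ^ n • a ≤ a := by
  simpa using pow_smul_antitone h (Nat.zero_le n)

theorem pow_smul_lt (h : g • a < a) {n : ℕ} (hn : n ≠ 0) : g ^ n • a < a := by
  simpa using pow_smul_strictAnti h (Nat.pos_of_ne_zero hn)

theorem smul_lt_iff_neg [TreePocset A] : g • a < a ↔ g⁻¹ • (-a) < -a := by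
  rw [smul_neg_eq, neg_lt_neg_iff_lt, lt_smul_iff, inv_inv]

variable [TreePocset A]

/-- Otherwise the infinitely many translates `g ^ n • a` would all lie in the finite interval from
`b` to `a`. -/
theorem exists_not_le_pow_smul (h : g • a < a) (b : A) : ∃ n : ℕ, ¬ b ≤ g ^ n • a := by
  by_contra! hb
  refine Set.infinite_of_injective_forall_mem (pow_smul_strictAnti h).injective
    (fun n => ?_) (finite_Icc b a)
  exact ⟨hb n, pow_smul_le h.le n⟩

/-- If `g⁻¹ • f ≤ f`, then every `g⁻¹ ^ n • e` stays below `f`, although these translates increase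
beyond any bound. -/
theorem not_le_smul_self (hg : g • e < e) (hef : e ≤ f) : ¬ f ≤ g • f := by
  intro hf
  obtain ⟨n, hn⟩ := exists_not_le_pow_smul (smul_lt_iff_neg.1 hg) (-f)
  apply hn
  rw [smul_neg_eq, neg_le_neg_iff_le]
  have : g⁻¹ • f ≤ f := by rwa [← le_smul_iff]
  exact ((smul_le_smul_iff _).2 hef).trans (pow_smul_le this n)

theorem smul_lt_of_le_or_le (hg : g • e < e) (hef : e ≤ f) (h : f ≤ g • f ∨ g • f ≤ f) :
    g • f < f := by
  have := not_le_smul_self hg hef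
  exact lt_of_le_not_ge (h.resolve_left this) this

end Action

end TreePocset

/-! ### Geometry of a class of coaxial edges -/

namespace Coaxial

open TreePocset TreePocsetAction

variable {G A : Type*} [Group G] [MulAction G A] [PartialOrder A] {a b c e f y : A} {g k : G}

theorem refl (a : A) : Coaxial G a a := fun _ => Iff.rfl

theorem symm (h : Coaxial G a b) : Coaxial G b a := fun g => (h g).symm

theorem trans (h : Coaxial G a b) (h' : Coaxial G b c) : Coaxial G a c :=
  fun g => (h g).trans (h' g)

variable [InvolutiveNeg A] [TreePocsetAction G A]

theorem smul (k : G) (h : Coaxial G a b) : Coaxial G (k • a) (k • b) := by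
  intro g
  have := h (k⁻¹ * g * k)
  rwa [mul_smul, mul_smul, mul_smul, mul_smul, smul_lt_iff (b := a), smul_lt_iff (b := b),
    inv_inv] at this

theorem smul_iff (k : G) : Coaxial G (k • a) (k • b) ↔ Coaxial G a b :=
  ⟨fun h => by simpa using h.smul k⁻¹, smul k⟩

variable [TreePocset A]

theorem neg (h : Coaxial G a b) : Coaxial G (-a) (-b) := by
  intro g
  rw [smul_lt_iff_neg, smul_lt_iff_neg (a := -b), neg_neg, neg_neg]
  exact h _

theorem neg_iff : Coaxial G (-a) (-b) ↔ Coaxial G a b :=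
  ⟨fun h => by simpa using h.neg, neg⟩

theorem not_le_neg (hax : ∀ a : A, ∃ g : G, g • a < a) (h : Coaxial G a b) : ¬ a ≤ -b := by
  intro hab
  obtain ⟨g, hg⟩ := hax a
  refine not_le_smul_self hg hab ?_
  rw [smul_neg_eq, neg_le_neg_iff_le]
  exact ((h g).1 hg).le

theorem le_or_le (hax : ∀ a : A, ∃ g : G, g • a < a) (h : Coaxial G a b) : a ≤ b ∨ b ≤ a := by
  refine TreePocset.le_or_le (h.not_le_neg hax) fun h' => ?_
  exact h.neg.not_le_neg hax (by simpa using h')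

theorem not_coaxial_neg (hax : ∀ a : A, ∃ g : G, g • a < a) (h : Coaxial G a b) :
    ¬ Coaxial G a (-b) := by
  intro h'
  have hb : Coaxial G b (-b) := h.symm.trans h'
  exact hb.not_le_neg hax (by simp)

theorem exists_smul_le (h : Coaxial G e f) (hef : e ≤ f) (hg : ∃ g : G, g • e < e) :
    ∃ g : G, g • f ≤ e := by
  obtain ⟨g, hg⟩ := hg
  have hf := (h g).1 hg
  obtain ⟨n, hn⟩ := exists_not_le_pow_smul hf e
  refine ⟨g ^ n, (TreePocset.le_or_le ?_ ?_).resolve_right hn⟩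
  · intro h1
    rw [TreePocset.le_neg_comm] at h1
    exact TreePocset.not_le_neg ((smul_le_smul_iff (g ^ n)).2 hef)
      ((pow_smul_le hg.le n).trans h1)
  · intro h1
    rw [TreePocset.neg_le_comm] at h1
    exact not_neg_le hef (h1.trans (pow_smul_le hf.le n))

/-- The edge `y` branches off between `e` and `f`, and high powers of `k` push the complement of `y`
away from itself. Coaxiality excludes the position `-y ≤ k ^ n • e`: there `k ^ n` would expand `e`,
hence also `f`, while it shrinks `y ≤ f`. -/
theorem exists_forall_pow_smul_le (h : Coaxial G e f) (hyf : y < f) (hye : y < -e)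
    (hk : k • y < y) : ∃ n₀, ∀ n ≥ n₀, k ^ n • e ≤ y := by
  suffices ∃ n : ℕ, k ^ n • e ≤ y by
    obtain ⟨n₀, hn₀⟩ := this
    refine ⟨n₀, fun n hn => ?_⟩
    obtain ⟨m, rfl⟩ := Nat.exists_eq_add_of_le hn
    rw [add_comm, pow_add, mul_smul]
    exact ((smul_le_smul_iff _).2 hn₀).trans (pow_smul_le hk.le m)
  obtain ⟨n, hn⟩ : ∃ n : ℕ, ¬ y ≤ -(k ^ n • e) := by
    by_contra! hcon
    obtain ⟨n, hn⟩ := exists_not_le_pow_smul (smul_lt_iff_neg.1 hk) e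
    refine hn ?_
    rw [inv_pow, ← smul_le_iff, TreePocset.le_neg_comm]
    exact hcon n
  refine ⟨n, ?_⟩
  rcases nested y (k ^ n • e) with h1 | h1 | h1 | h1
  · exfalso
    have h2 : y ≤ e := by
      rw [le_smul_iff] at h1
      refine le_trans ?_ h1
      rw [← smul_le_iff]
      exact pow_smul_le hk.le n
    exact TreePocset.not_le_neg h2 hye.le
  · exact absurd h1 hn
  · exfalso
    have h2 : e < k ^ n • e := lt_of_lt_of_le (lt_neg_comm.1 hye) h1
    have hn0 : n ≠ 0 := by rintro rfl; simp at h2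
    have h3 : f < k ^ n • f := by
      rw [lt_smul_iff] at h2 ⊢
      exact (h _).1 h2
    exact not_le_smul_self (pow_smul_lt hk hn0) hyf.le h3.le
  · exact h1

/-- There is no branching between two coaxial edges. -/
theorem not_branch (hax : ∀ a : A, ∃ g : G, g • a < a) (h : Coaxial G e f) (hef : e ≤ f)
    (hyf : y < f) (hye : y < -e) : False := by
  obtain ⟨g, hg⟩ := h.exists_smul_le hef (hax e)
  obtain ⟨k, hk⟩ := hax y
  obtain ⟨n₁, h₁⟩ := h.exists_forall_pow_smul_le hyf hye hk
  obtain ⟨n₂, h₂⟩ := h.symm.neg.exists_forall_pow_smul_le (y := y) hye (by simpa using hyf) hk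
  set n := max n₁ n₂
  replace h₁ := h₁ n (le_max_left _ _)
  replace h₂ := h₂ n (le_max_right _ _)
  -- Ping-pong with a commutator: it maps everything below `-y` strictly below `e`. Applied to `e`
  -- it is a translation along `e`, hence along `f`; applied to `-f` it contradicts this.
  have key : ∀ x, x ≤ -y → (g * k ^ n * g⁻¹ * (k ^ n)⁻¹) • x < e := by
    intro x hx
    have h3 : (k ^ n)⁻¹ • x ≤ -e := by
      rw [← le_smul_iff, smul_neg_eq]
      exact hx.trans (neg_le_neg h₁)
    have h4 : g⁻¹ • (k ^ n)⁻¹ • x ≤ -f := by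
      rw [← le_smul_iff, smul_neg_eq]
      exact h3.trans (neg_le_neg hg)
    have h5 : k ^ n • g⁻¹ • (k ^ n)⁻¹ • x < f :=
      (((smul_le_smul_iff _).2 h4).trans h₂).trans_lt hyf
    rw [mul_smul, mul_smul, mul_smul]
    exact lt_of_lt_of_le ((smul_lt_smul_iff _).2 h5) hg
  have h6 := (h _).1 (key e (TreePocset.le_neg_comm.1 hye.le))
  have h7 := key (-f) (neg_le_neg hyf.le)
  rw [smul_neg_eq] at h7
  exact not_neg_le h6.le (h7.le.trans hef)

/-- An element that shrinks `e` and `e'` squeezes `f` between them. Conversely, if `g` shrinks `f`,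
some power brings `f` below `e`; since nothing branches off, `e` and `g • e` are comparable, and `g`
cannot expand `e`. -/
theorem of_le_of_le (hax : ∀ a : A, ∃ g : G, g • a < a) {e' : A} (h : Coaxial G e e')
    (hef : e ≤ f) (hfe' : f ≤ e') : Coaxial G e f := by
  intro g
  constructor
  · intro hg
    have hg' := (h g).1 hg
    refine smul_lt_of_le_or_le hg hef (TreePocset.le_or_le ?_ ?_)
    · intro h1
      exact TreePocset.not_le_neg ((smul_le_smul_iff g).2 hef)
        ((hg.le.trans hef).trans h1)
    · intro h1
      exact not_neg_le hfe' (h1.trans (((smul_le_smul_iff g).2 hfe').trans hg'.le))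
  · intro hg
    rcases hef.eq_or_lt with rfl | hef'
    · exact hg
    obtain ⟨n, hn⟩ := exists_not_le_pow_smul hg e
    have hn0 : n ≠ 0 := by rintro rfl; simp [hef] at hn
    have h1 : g ^ n • f < e := by
      refine lt_of_le_of_ne ((TreePocset.le_or_le ?_ ?_).resolve_left hn) (fun h => hn h.ge)
      · intro h1
        refine h.not_branch hax (hef.trans hfe') ((pow_smul_lt hg hn0).trans_le hfe')
          (lt_of_le_of_ne (TreePocset.le_neg_comm.1 h1) fun h2 => ?_)
        have : -e < f := h2 ▸ pow_smul_lt hg hn0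
        exact not_neg_le hef this.le
      · intro h1
        exact not_neg_le hef (h1.trans (pow_smul_le hg.le n))
    have hge : g • e ≤ f := ((smul_lt_smul_iff g).2 hef').le.trans hg.le
    have h2 : e ≤ g • e ∨ g • e ≤ e := by
      refine TreePocset.le_or_le ?_ ?_
      · intro h1
        refine h.not_branch hax (hef.trans hfe') (y := g • e)
          ((((smul_lt_smul_iff g).2 hef').trans hg).trans_le hfe')
          (lt_of_le_of_ne (TreePocset.le_neg_comm.1 h1) (smul_ne_neg g e))
      · intro h1
        exact not_neg_le hef (h1.trans hge)
    refine lt_of_le_not_ge (h2.resolve_left ?_) ?_ <;>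
    · intro h3
      have h4 : g⁻¹ • e ≤ e := by rwa [← le_smul_iff]
      have h5 := pow_smul_le h4 n
      rw [inv_pow, ← le_smul_iff] at h5
      exact lt_irrefl e (h5.trans_lt (((smul_lt_smul_iff _).2 hef').trans h1))

/-- For `e ≤ e'`, the edge `f` is not between them by convexity, and `-f` cannot branch off there.
-/
theorem lt_of_lt_left (hax : ∀ a : A, ∃ g : G, g • a < a) {e' : A} (h : Coaxial G e e')
    (hn : ¬ Coaxial G e f) (hef : e < f) : e' < f := by
  have hne : e' ≠ f := by rintro rfl; exact hn h
  rcases h.le_or_le hax with h1 | h1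
  · rcases nested e' f with h2 | h2 | h2 | h2
    · exact lt_of_le_of_ne h2 hne
    · exact absurd (h1.trans h2) (TreePocset.not_le_neg hef.le)
    · rw [TreePocset.neg_le_comm] at h2
      refine (h.not_branch hax h1 (lt_of_le_of_ne h2 ?_) (neg_lt_neg_iff_lt.2 hef)).elim
      rintro rfl
      exact TreePocset.not_le_neg hef.le h1
    · exact absurd (h.of_le_of_le hax hef.le h2) hn
  · exact h1.trans_lt hef

theorem lt_of_lt_right (hax : ∀ a : A, ∃ g : G, g • a < a) {f' : A} (h : Coaxial G f f')
    (hn : ¬ Coaxial G e f) (hef : e < f) : e < f' := by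
  rw [← neg_lt_neg_iff_lt] at hef ⊢
  exact h.neg.lt_of_lt_left hax (fun h' => hn (neg_iff.1 h').symm) hef

end Coaxial

/-! ### Bijections that may reorder coaxial edges -/

/-- An equivariant bijection between tree pocsets which preserves the order inside each orbit of
unoriented edges. -/
structure AgreesOnOrbits (G : Type*) {A B : Type*} [Group G] [MulAction G A] [MulAction G B]
    [PartialOrder A] [PartialOrder B] [InvolutiveNeg A] [InvolutiveNeg B] (Θ : A ≃ B) :
    Prop where
  map_smul : ∀ (g : G) (a : A), Θ (g • a) = g • Θ a
  map_neg : ∀ a : A, Θ (-a) = -Θ a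
  smul_le_self : ∀ (g : G) (a : A), g • Θ a ≤ Θ a ↔ g • a ≤ a
  smul_le_neg : ∀ (g : G) (a : A), g • Θ a ≤ -Θ a ↔ g • a ≤ -a
  neg_le_smul : ∀ (g : G) (a : A), -Θ a ≤ g • Θ a ↔ -a ≤ g • a

namespace AgreesOnOrbits

open TreePocset TreePocsetAction

variable {G A B : Type*} [Group G] [MulAction G A] [MulAction G B]
    [PartialOrder A] [PartialOrder B] [InvolutiveNeg A] [InvolutiveNeg B] {Θ : A ≃ B}
    {e f : A}

theorem symm (h : AgreesOnOrbits G Θ) : AgreesOnOrbits G Θ.symm where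
  map_smul g b := by rw [Equiv.symm_apply_eq, h.map_smul, Equiv.apply_symm_apply]
  map_neg b := by rw [Equiv.symm_apply_eq, h.map_neg, Equiv.apply_symm_apply]
  smul_le_self g b := by simpa using (h.smul_le_self g (Θ.symm b)).symm
  smul_le_neg g b := by simpa using (h.smul_le_neg g (Θ.symm b)).symm
  neg_le_smul g b := by simpa using (h.neg_le_smul g (Θ.symm b)).symm

theorem smul_lt_self (h : AgreesOnOrbits G Θ) (g : G) (a : A) : g • Θ a < Θ a ↔ g • a < a := by
  rw [lt_iff_le_and_ne, lt_iff_le_and_ne, h.smul_le_self, ← h.map_smul, Θ.injective.ne_iff]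

theorem coaxial_iff (h : AgreesOnOrbits G Θ) : Coaxial G (Θ e) (Θ f) ↔ Coaxial G e f := by
  simp only [Coaxial, h.smul_lt_self]

theorem exists_smul_lt (h : AgreesOnOrbits G Θ) (hax : ∀ a : A, ∃ g : G, g • a < a) (b : B) :
    ∃ g : G, g • b < b := by
  obtain ⟨g, hg⟩ := hax (Θ.symm b)
  exact ⟨g, by simpa using (h.smul_lt_self g _).2 hg⟩

variable [TreePocsetAction G A] [TreePocsetAction G B] [TreePocset A] [TreePocset B]

/-- Take `g` shrinking `e`. It must shrink `f` as well, the bad position of `f` and `g • f` being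
excluded on the side of `B`. Then `g` shrinks `Θ e` and expands `-Θ f`, so the first cannot be below
the second. -/
theorem not_le_neg_of_le (h : AgreesOnOrbits G Θ) (hax : ∀ a : A, ∃ g : G, g • a < a)
    (hef : e ≤ f) : ¬ Θ e ≤ -Θ f := by
  intro hΘ
  obtain ⟨g, hg⟩ := hax e
  have hg' := (h.smul_lt_self g e).2 hg
  have h1 : f ≤ g • f ∨ g • f ≤ f := by
    refine le_or_le ?_ ?_
    · intro h1
      exact not_le_neg ((smul_le_smul_iff g).2 hef) ((hg.le.trans hef).trans h1)
    · rw [← h.neg_le_smul]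
      intro h1
      have h2 := (smul_le_smul_iff g).2 hΘ
      rw [smul_neg_eq] at h2
      exact not_le_neg ((hg'.le.trans hΘ).trans h1) h2
  have h2 := smul_lt_of_le_or_le hg hef h1
  refine not_le_smul_self hg' hΘ ?_
  rw [smul_neg_eq, neg_le_neg_iff_le, h.smul_le_self]
  exact h2.le

theorem smul_lt_of_conflict (h : AgreesOnOrbits G Θ) (hef : e ≤ f) (hΘ : Θ f ≤ Θ e) (g : G)
    (hg : g • e < e) : g • f < f := by
  have hg' := (h.smul_lt_self g e).2 hg
  refine smul_lt_of_le_or_le hg hef (le_or_le ?_ ?_)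
  · intro h1
    exact not_le_neg ((smul_le_smul_iff g).2 hef) ((hg.le.trans hef).trans h1)
  · rw [← h.neg_le_smul]
    intro h1
    exact not_neg_le hΘ (h1.trans (((smul_le_smul_iff g).2 hΘ).trans hg'.le))

/-- The hypothesis is symmetric under exchanging `Θ` with its inverse, so one implication, applied
on both sides, gives the equivalence. -/
theorem coaxial_of_conflict (h : AgreesOnOrbits G Θ) (hef : e ≤ f) (hΘ : Θ f ≤ Θ e) :
    Coaxial G e f := fun g =>
  ⟨h.smul_lt_of_conflict hef hΘ g, fun hg => (h.smul_lt_self g e).1 <|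
    h.symm.smul_lt_of_conflict hΘ (by simpa using hef) g ((h.smul_lt_self g f).2 hg)⟩

theorem map_lt_of_lt (h : AgreesOnOrbits G Θ) (hax : ∀ a : A, ∃ g : G, g • a < a)
    (hef : e < f) (hn : ¬ Coaxial G e f) : Θ e < Θ f := by
  refine lt_of_le_of_ne ?_ (Θ.injective.ne hef.ne)
  rcases nested (Θ e) (Θ f) with h1 | h1 | h1 | h1
  · exact h1
  · exact absurd h1 (h.not_le_neg_of_le hax hef.le)
  · have := h.not_le_neg_of_le hax (neg_le_neg hef.le)
    rw [h.map_neg, h.map_neg, neg_neg] at this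
    exact absurd (neg_le_comm.1 h1) this
  · exact absurd (h.coaxial_of_conflict hef.le h1) hn

/-- Heights on the classes of coaxial edges which match up under `Θ` give an isomorphism. -/
theorem exists_orderIso (h : AgreesOnOrbits G Θ) (hax : ∀ a : A, ∃ g : G, g • a < a)
    (hA : A → ℤ) (hB : B → ℤ)
    (monoA : ∀ {e f}, Coaxial G e f → e < f → hA e < hA f)
    (monoB : ∀ {e f}, Coaxial G e f → e < f → hB e < hB f)
    (exB : ∀ e, ∃ y, Coaxial G (Θ e) y ∧ hB y = hA e)
    (exA : ∀ y, ∃ e, Coaxial G (Θ e) y ∧ hB y = hA e)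
    (smul_eq : ∀ (g : G) {e y}, Coaxial G (Θ e) y → hB y = hA e → hB (g • y) = hA (g • e))
    (negA : ∀ e, hA (-e) = -hA e) (negB : ∀ y, hB (-y) = -hB y) :
    ∃ F : A ≃o B, (∀ (g : G) a, F (g • a) = g • F a) ∧ ∀ a, F (-a) = -F a := by
  have haxB := h.exists_smul_lt hax
  have injA : ∀ {e f}, Coaxial G e f → hA e = hA f → e = f := by
    intro e f hef heq
    by_contra hne
    rcases hef.le_or_le hax with h1 | h1
    · exact (monoA hef (lt_of_le_of_ne h1 hne)).ne heq
    · exact (monoA hef.symm (lt_of_le_of_ne h1 (Ne.symm hne))).ne heq.symm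
  have injB : ∀ {e f}, Coaxial G e f → hB e = hB f → e = f := by
    intro e f hef heq
    by_contra hne
    rcases hef.le_or_le haxB with h1 | h1
    · exact (monoB hef (lt_of_le_of_ne h1 hne)).ne heq
    · exact (monoB hef.symm (lt_of_le_of_ne h1 (Ne.symm hne))).ne heq.symm
  -- `F e` is the member of the class of `Θ e` that has the height of `e`; heights are injective on
  -- classes, so it is unique.
  choose F hF hFh using exB
  have Funiq : ∀ {e y}, Coaxial G (Θ e) y → hB y = hA e → F e = y := fun {e y} h1 h2 =>
    injB ((hF e).symm.trans h1) ((hFh e).trans h2.symm)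
  have Fsmul : ∀ (g : G) a, F (g • a) = g • F a := fun g a =>
    Funiq (by rw [h.map_smul]; exact (hF a).smul g) (smul_eq g (hF a) (hFh a))
  have Fneg : ∀ a, F (-a) = -F a := fun a =>
    Funiq (by rw [h.map_neg]; exact (hF a).neg) (by rw [negA, negB, hFh])
  have Fbij : Function.Bijective F := by
    constructor
    · intro e f hef
      refine injA (h.coaxial_iff.1 ((hF e).trans (hef ▸ (hF f).symm))) ?_
      rw [← hFh, ← hFh, hef]
    · intro y
      obtain ⟨e, h1, h2⟩ := exA y
      exact ⟨e, Funiq h1 h2⟩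
  have Flt : ∀ {e f}, e < f → F e < F f := by
    intro e f hef
    by_cases hc : Coaxial G e f
    · have hc' : Coaxial G (F e) (F f) :=
        (hF e).symm.trans ((h.coaxial_iff.2 hc).trans (hF f))
      have hlt := monoA hc hef
      rcases hc'.le_or_le haxB with h1 | h1
      · exact lt_of_le_of_ne h1 (Fbij.1.ne hef.ne)
      · have := monoB hc'.symm (lt_of_le_of_ne h1 (Fbij.1.ne hef.ne'))
        rw [hFh, hFh] at this
        exact absurd this hlt.not_gt
    -- Between different classes `Θ` is already monotone, and moving either edge within its class
    -- keeps the inequality.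
    · have h1 := h.map_lt_of_lt hax hef hc
      have h2 := (hF e).lt_of_lt_left haxB (mt h.coaxial_iff.1 hc) h1
      refine (hF f).lt_of_lt_right haxB (fun h3 => ?_) h2
      exact hc (h.coaxial_iff.1 ((hF e).trans h3))
  have Fle : ∀ {e f}, e ≤ f → F e ≤ F f := fun {e f} hef => by
    rcases hef.eq_or_lt with rfl | h1
    · exact le_rfl
    · exact (Flt h1).le
  refine ⟨⟨Equiv.ofBijective F Fbij, fun {e f} => ⟨fun hef => ?_, Fle⟩⟩, Fsmul, Fneg⟩
  replace hef : F e ≤ F f := hef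
  rcases nested e f with h1 | h1 | h1 | h1
  · exact h1
  · exact absurd (Fneg f ▸ Fle h1) (not_le_neg hef)
  · exact absurd (Fneg e ▸ Fle h1) (not_neg_le hef)
  · rcases h1.eq_or_lt with rfl | h1
    · exact le_rfl
    · exact absurd hef (Flt h1).not_ge

end AgreesOnOrbits

open TreePocset TreePocsetAction

/-! ### Finite classes: heights from ranks -/

section FiniteClasses

variable {G A B : Type*} [Group G] [MulAction G A] [MulAction G B]
    [PartialOrder A] [PartialOrder B]

/-- The number of smaller edges minus the number of larger edges in a class of coaxial edges. -/
noncomputable def classHeight (G : Type*) {A : Type*} [Group G] [MulAction G A] [PartialOrder A]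
    (a : A) : ℤ :=
  ({x | Coaxial G a x ∧ x < a}.ncard : ℤ) - {x | Coaxial G a x ∧ a < x}.ncard

theorem ncard_lt_mono (hfin : ∀ a : A, {x | Coaxial G a x}.Finite) {e f : A}
    (h : Coaxial G e f) (hef : e < f) :
    {x | Coaxial G e x ∧ x < e}.ncard < {x | Coaxial G f x ∧ x < f}.ncard := by
  refine Set.ncard_lt_ncard ⟨fun x hx => ⟨h.symm.trans hx.1, hx.2.trans hef⟩, fun hsub => ?_⟩
    ((hfin f).subset fun x hx => hx.1)
  exact lt_irrefl e (hsub ⟨h.symm, hef⟩ : _ ∧ _).2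

theorem classHeight_strictMono (hfin : ∀ a : A, {x | Coaxial G a x}.Finite) {e f : A}
    (h : Coaxial G e f) (hef : e < f) : classHeight G e < classHeight G f := by
  have h1 := ncard_lt_mono hfin h hef
  have h2 : {x | Coaxial G f x ∧ f < x}.ncard ≤ {x | Coaxial G e x ∧ e < x}.ncard :=
    Set.ncard_le_ncard (fun x hx => ⟨h.trans hx.1, hef.trans hx.2⟩)
      ((hfin e).subset fun x hx => hx.1)
  unfold classHeight
  omega

/-- Two members of a class with the same orbit representative differ by a group element keeping one
of them in its class, hence fixing it. So a class embeds into the finite set of representatives. -/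
theorem Coaxial.finite_of_smul_eq (hfix : ∀ (a : A) (g : G), Coaxial G a (g • a) → g • a = a)
    (hfin : ∃ s : Set A, s.Finite ∧ ∀ x : A, ∃ g : G, g • x ∈ s) (a : A) :
    {x | Coaxial G a x}.Finite := by
  obtain ⟨s, hs, hsx⟩ := hfin
  choose γ hγ using hsx
  refine Set.Finite.of_finite_image (f := fun x => γ x • x)
    (hs.subset (by rintro _ ⟨x, -, rfl⟩; exact hγ x)) ?_
  intro x hx y hy hxy
  simp only at hxy
  have h1 : x = ((γ x)⁻¹ * γ y) • y := by rw [mul_smul, ← hxy, inv_smul_smul]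
  have h2 : Coaxial G y x := Coaxial.trans (Coaxial.symm hy) hx
  rw [h1] at h2
  rw [h1, hfix _ _ h2]

variable [InvolutiveNeg A] [InvolutiveNeg B] {Θ : A ≃ B}

theorem AgreesOnOrbits.image_class (h : AgreesOnOrbits G Θ) (a : A) :
    {y | Coaxial G (Θ a) y} = Θ '' {x | Coaxial G a x} := by
  ext y
  constructor
  · intro hy
    refine ⟨Θ.symm y, h.coaxial_iff.1 ?_, Θ.apply_symm_apply y⟩
    rwa [Θ.apply_symm_apply]
  · rintro ⟨x, hx, rfl⟩
    exact h.coaxial_iff.2 hx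

variable [TreePocsetAction G A] [TreePocsetAction G B]

theorem classHeight_smul (g : G) (a : A) : classHeight G (g • a) = classHeight G a := by
  have h1 : {x | Coaxial G (g • a) x ∧ x < g • a} = (g • ·) '' {x | Coaxial G a x ∧ x < a} := by
    ext x
    refine ⟨fun hx => ⟨g⁻¹ • x, ⟨?_, ?_⟩, smul_inv_smul g x⟩, ?_⟩
    · simpa using hx.1.smul g⁻¹
    · exact lt_smul_iff.1 hx.2
    · rintro ⟨y, hy, rfl⟩
      exact ⟨hy.1.smul g, (smul_lt_smul_iff g).2 hy.2⟩
  have h2 : {x | Coaxial G (g • a) x ∧ g • a < x} = (g • ·) '' {x | Coaxial G a x ∧ a < x} := by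
    ext x
    refine ⟨fun hx => ⟨g⁻¹ • x, ⟨?_, ?_⟩, smul_inv_smul g x⟩, ?_⟩
    · simpa using hx.1.smul g⁻¹
    · exact smul_lt_iff.1 hx.2
    · rintro ⟨y, hy, rfl⟩
      exact ⟨hy.1.smul g, (smul_lt_smul_iff g).2 hy.2⟩
  rw [classHeight, classHeight, h1, h2, Set.ncard_image_of_injective _ (MulAction.injective g),
    Set.ncard_image_of_injective _ (MulAction.injective g)]

variable [TreePocset A] [TreePocset B]

/-- Negation reverses a class and so swaps the two counts. This is why the height is a difference
rather than a rank. -/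
theorem classHeight_neg (a : A) : classHeight G (-a) = -classHeight G a := by
  have h1 : {x | Coaxial G (-a) x ∧ x < -a} = (- ·) '' {x | Coaxial G a x ∧ a < x} := by
    ext x
    refine ⟨fun hx => ⟨-x, ⟨?_, ?_⟩, neg_neg x⟩, ?_⟩
    · simpa using hx.1.neg
    · exact lt_neg_comm.1 hx.2
    · rintro ⟨y, hy, rfl⟩
      exact ⟨hy.1.neg, neg_lt_neg_iff_lt.2 hy.2⟩
  have h2 : {x | Coaxial G (-a) x ∧ -a < x} = (- ·) '' {x | Coaxial G a x ∧ x < a} := by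
    ext x
    refine ⟨fun hx => ⟨-x, ⟨?_, ?_⟩, neg_neg x⟩, ?_⟩
    · simpa using hx.1.neg
    · have := neg_lt_neg_iff_lt.2 hx.2
      rwa [neg_neg] at this
    · rintro ⟨y, hy, rfl⟩
      exact ⟨hy.1.neg, neg_lt_neg_iff_lt.2 hy.2⟩
  rw [classHeight, classHeight, h1, h2, Set.ncard_image_of_injective _ neg_injective,
    Set.ncard_image_of_injective _ neg_injective]
  ring

theorem ncard_lt_add_ncard_gt (hax : ∀ a : A, ∃ g : G, g • a < a)
    (hfin : ∀ a : A, {x | Coaxial G a x}.Finite) (a : A) :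
    {x | Coaxial G a x ∧ x < a}.ncard + {x | Coaxial G a x ∧ a < x}.ncard + 1 =
      {x | Coaxial G a x}.ncard := by
  have h1 : {x | Coaxial G a x} =
      insert a ({x | Coaxial G a x ∧ x < a} ∪ {x | Coaxial G a x ∧ a < x}) := by
    ext x
    constructor
    · intro hx
      rcases eq_or_ne x a with rfl | hne
      · exact Or.inl rfl
      rcases Coaxial.le_or_le hax hx with h | h
      · exact Or.inr (Or.inr ⟨hx, lt_of_le_of_ne h hne.symm⟩)
      · exact Or.inr (Or.inl ⟨hx, lt_of_le_of_ne h hne⟩)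
    · rintro (rfl | hx | hx)
      exacts [Coaxial.refl _, hx.1, hx.1]
  have f1 : {x | Coaxial G a x ∧ x < a}.Finite := (hfin a).subset fun x hx => hx.1
  have f2 : {x | Coaxial G a x ∧ a < x}.Finite := (hfin a).subset fun x hx => hx.1
  rw [h1, Set.ncard_insert_of_notMem _ (f1.union f2), Set.ncard_union_eq _ f1 f2]
  · rw [Set.disjoint_left]
    exact fun x hx hx' => lt_asymm hx.2 hx'.2
  · rintro (h | h) <;> exact lt_irrefl a h.2

/-- The rank is injective on the chain and smaller than its cardinality, so by counting every
possible rank occurs. -/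
theorem exists_ncard_lt_eq (hax : ∀ a : A, ∃ g : G, g • a < a)
    (hfin : ∀ a : A, {x | Coaxial G a x}.Finite) (a : A) {i : ℕ}
    (hi : i < {x | Coaxial G a x}.ncard) :
    ∃ y, Coaxial G a y ∧ {x | Coaxial G y x ∧ x < y}.ncard = i := by
  have hclass : ∀ {y}, Coaxial G a y → {x | Coaxial G y x} = {x | Coaxial G a x} :=
    fun {y} hy => Set.ext fun x => ⟨hy.trans, hy.symm.trans⟩
  have hsub : (fun y => {x | Coaxial G y x ∧ x < y}.ncard) '' {x | Coaxial G a x} ⊆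
      Set.Iio {x | Coaxial G a x}.ncard := by
    rintro _ ⟨y, hy, rfl⟩
    have := ncard_lt_add_ncard_gt hax hfin y
    rw [hclass hy] at this
    simp only [Set.mem_Iio]
    omega
  have hinj : Set.InjOn (fun y => {x | Coaxial G y x ∧ x < y}.ncard) {x | Coaxial G a x} := by
    intro y hy z hz hyz
    by_contra hne
    have hyz' : Coaxial G y z := Coaxial.trans (Coaxial.symm hy) hz
    rcases hyz'.le_or_le hax with h | h
    · exact (ncard_lt_mono hfin hyz' (lt_of_le_of_ne h hne)).ne hyz
    · exact (ncard_lt_mono hfin hyz'.symm (lt_of_le_of_ne h (Ne.symm hne))).ne hyz.symm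
  have heq := Set.eq_of_subset_of_ncard_le hsub
    (by rw [hinj.ncard_image, Set.ncard_Iio_nat]) (Set.finite_Iio _)
  have : i ∈ Set.Iio {x | Coaxial G a x}.ncard := hi
  rw [← heq] at this
  exact this

theorem AgreesOnOrbits.exists_classHeight_eq (h : AgreesOnOrbits G Θ)
    (hax : ∀ a : A, ∃ g : G, g • a < a)
    (hfin : ∀ a : A, {x | Coaxial G a x}.Finite) (hfinB : ∀ a : B, {x | Coaxial G a x}.Finite)
    (a : A) : ∃ y, Coaxial G (Θ a) y ∧ classHeight G y = classHeight G a := by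
  have h1 := ncard_lt_add_ncard_gt hax hfin a
  have hcard : {y | Coaxial G (Θ a) y}.ncard = {x | Coaxial G a x}.ncard := by
    rw [h.image_class, Set.ncard_image_of_injective _ Θ.injective]
  obtain ⟨y, hy, hyc⟩ := exists_ncard_lt_eq (h.exists_smul_lt hax) hfinB (Θ a)
    (i := {x | Coaxial G a x ∧ x < a}.ncard) (by omega)
  refine ⟨y, hy, ?_⟩
  have h2 := ncard_lt_add_ncard_gt (h.exists_smul_lt hax) hfinB y
  have h3 : {x | Coaxial G y x} = {x | Coaxial G (Θ a) x} :=
    Set.ext fun x => ⟨hy.trans, hy.symm.trans⟩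
  rw [h3] at h2
  unfold classHeight
  omega

theorem AgreesOnOrbits.exists_orderIso_of_finite (h : AgreesOnOrbits G Θ)
    (hax : ∀ a : A, ∃ g : G, g • a < a)
    (hfin : ∀ a : A, {x | Coaxial G a x}.Finite) :
    ∃ F : A ≃o B, (∀ (g : G) a, F (g • a) = g • F a) ∧ ∀ a, F (-a) = -F a := by
  have hfinB : ∀ b : B, {x | Coaxial G b x}.Finite := by
    intro b
    have := h.image_class (Θ.symm b)
    rw [Θ.apply_symm_apply] at this
    rw [this]
    exact (hfin _).image _
  refine h.exists_orderIso hax (classHeight G) (classHeight G)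
    (classHeight_strictMono hfin) (classHeight_strictMono hfinB)
    (h.exists_classHeight_eq hax hfin hfinB) (fun y => ?_) (fun g e y _ hy => ?_)
    classHeight_neg classHeight_neg
  · obtain ⟨e, he, hey⟩ := h.symm.exists_classHeight_eq (h.exists_smul_lt hax) hfinB hfin y
    refine ⟨e, ?_, hey.symm⟩
    have := h.coaxial_iff.2 he
    rw [Θ.apply_symm_apply] at this
    exact this.symm
  · rw [classHeight_smul, classHeight_smul, hy]

end FiniteClasses

/-! ### A single line: heights from coordinates -/

theorem Int.apply_eq_add_of_strictMono {f : ℤ → ℤ} (hf : StrictMono f)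
    (hs : Function.Surjective f) (n : ℤ) : f n = n + f 0 := by
  have hsucc : ∀ n, f (n + 1) = f n + 1 := fun n => by
    have := (hf.orderIsoOfSurjective f hs).map_succ n
    simpa using this
  induction n using Int.induction_on with
  | zero => simp
  | succ k ih => rw [hsucc, ih]; ring
  | pred k ih =>
    have := hsucc (-(k : ℤ) - 1)
    rw [sub_add_cancel, ih] at this
    omega

section Line

variable {G A B : Type*} [Group G] [MulAction G A] [MulAction G B]
    [PartialOrder A] [PartialOrder B] [InvolutiveNeg A] [InvolutiveNeg B] {Θ : A ≃ B}

/-- Two elements of the class of `a` are equivalent if they differ by a power of `g`. -/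
def classOrbitSetoid (a : A) (g : G) : Setoid {x : A // Coaxial G a x} where
  r x y := ∃ k : ℤ, g ^ k • x.1 = y.1
  iseqv :=
    { refl := fun x => ⟨0, by simp⟩
      symm := by
        rintro x y ⟨k, hk⟩
        exact ⟨-k, by rw [← hk, zpow_neg, inv_smul_smul]⟩
      trans := by
        rintro x y z ⟨k, hk⟩ ⟨l, hl⟩
        exact ⟨l + k, by rw [← hl, ← hk, zpow_add, mul_smul]⟩ }

open Classical in
/-- The translation number of `g` on the class of `a`, counted as a number of orbits. -/
noncomputable def translationNumber (a : A) (g : G) : ℤ :=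
  (if g • a < a then -1 else 1) * (Nat.card (Quotient (classOrbitSetoid a g)) : ℤ)

/-- Counting orbits of `g` ignores the order of the class, and the sign compares only `a` with `g •
a`. Hence the number survives `Θ`, which may permute the class. -/
theorem AgreesOnOrbits.translationNumber_eq (h : AgreesOnOrbits G Θ) (a : A) (g : G) :
    translationNumber (Θ a) g = translationNumber a g := by
  have hcard : Nat.card (Quotient (classOrbitSetoid a g)) =
      Nat.card (Quotient (classOrbitSetoid (Θ a) g)) := by
    refine Nat.card_congr (Quotient.congr (Θ.subtypeEquiv fun x => h.coaxial_iff.symm) ?_)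
    intro x y
    change (∃ k : ℤ, g ^ k • x.1 = y.1) ↔ ∃ k : ℤ, g ^ k • Θ x.1 = Θ y.1
    simp only [← h.map_smul, Θ.injective.eq_iff]
  rw [translationNumber, translationNumber, hcard]
  by_cases hg : g • a < a
  · rw [if_pos hg, if_pos ((h.smul_lt_self g a).2 hg)]
  · rw [if_neg hg, if_neg (mt (h.smul_lt_self g a).1 hg)]

variable [TreePocsetAction G A] [TreePocsetAction G B] [TreePocset A] [TreePocset B]

/-- All `g ^ n • a` belong to the class and eventually pass below any given `x ≤ a`, so convexity
puts `x` into the class. Reversing orientations treats the other positions. -/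
theorem exists_line_of_smul_coaxial (hax : ∀ a : A, ∃ g : G, g • a < a) {a : A} {g : G}
    (h : Coaxial G a (g • a)) (hlt : g • a < a) (x : A) : Coaxial G a x ∨ Coaxial G a (-x) := by
  have key : ∀ {a x : A} {g : G}, Coaxial G a (g • a) → g • a < a → x ≤ a → Coaxial G a x := by
    intro a x g h hlt hxa
    have hpow : ∀ n : ℕ, Coaxial G a (g ^ n • a) := by
      intro n
      induction n with
      | zero => simpa using Coaxial.refl a
      | succ n ih =>
        rw [pow_succ', mul_smul]
        exact h.trans (ih.smul g)
    rcases hxa.eq_or_lt with rfl | hxa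
    · exact Coaxial.refl _
    obtain ⟨n, hn⟩ := exists_not_le_pow_smul hlt x
    have hle := pow_smul_le hlt.le n
    have h1 : g ^ n • a ≤ x := by
      refine (le_or_le ?_ ?_).resolve_left hn
      · intro h1
        refine (hpow n).symm.not_branch hax hle hxa (lt_of_le_of_ne h1 ?_)
        rintro rfl
        exact not_neg_le hle hxa.le
      · intro h1
        exact not_neg_le hxa.le (h1.trans hle)
    exact ((hpow n).symm.of_le_of_le hax h1 hxa.le).symm.trans (hpow n).symm |>.symm
  have key' : ∀ x, a ≤ x → Coaxial G a x := by
    intro x hx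
    have h1 : Coaxial G (-a) (g⁻¹ • (-a)) := by
      rw [smul_neg_eq, Coaxial.neg_iff]
      simpa using (h.smul g⁻¹).symm
    have := key h1 (smul_lt_iff_neg.1 hlt) (neg_le_neg hx)
    exact Coaxial.neg_iff.1 this
  rcases nested x a with h1 | h1 | h1 | h1
  · exact Or.inl (key h hlt h1)
  · exact Or.inr (key' _ (TreePocset.le_neg_comm.1 h1))
  · exact Or.inr (key h hlt h1)
  · exact Or.inl (key' _ h1)

/-- The class is a locally finite linear order without ends, hence a copy of `ℤ`. -/
theorem exists_coordinate (hax : ∀ a : A, ∃ g : G, g • a < a) {a : A}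
    (hline : ∀ x, Coaxial G a x ∨ Coaxial G a (-x)) :
    ∃ p : A → ℤ, (∀ x y, Coaxial G a x → Coaxial G a y → (p x < p y ↔ x < y)) ∧
      ∀ n, ∃ x, Coaxial G a x ∧ p x = n := by
  classical
  have hsmul : ∀ {x} {g : G}, Coaxial G a x → (g • x ≤ x ∨ x ≤ g • x) → Coaxial G a (g • x) := by
    intro x g hx hg
    refine (hline (g • x)).resolve_right fun h1 => ?_
    have h2 := hx.symm.trans h1
    rcases hg with hg | hg
    · exact (h2.neg.not_le_neg hax (by rw [neg_neg]; exact neg_le_neg hg)).elim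
    · exact h2.not_le_neg hax (by simpa using hg)
  let C := {x : A // Coaxial G a x}
  let _ : LinearOrder C :=
    { (inferInstance : PartialOrder C) with
      le_total := fun x y => Coaxial.le_or_le (A := A) hax (x.2.symm.trans y.2)
      toDecidableLE := Classical.decRel _
      toDecidableEq := Classical.decEq _
      toDecidableLT := Classical.decRel _ }
  let _ : LocallyFiniteOrder C := LocallyFiniteOrder.ofFiniteIcc fun x y => by
    refine Set.Finite.of_finite_image (f := Subtype.val) ((finite_Icc x.1 y.1).subset ?_)
      Subtype.val_injective.injOn
    rintro _ ⟨z, hz, rfl⟩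
    exact ⟨hz.1, hz.2⟩
  have _ : NoMinOrder C := ⟨fun x => by
    obtain ⟨g, hg⟩ := hax x.1
    exact ⟨⟨g • x.1, hsmul x.2 (Or.inl hg.le)⟩, hg⟩⟩
  have _ : NoMaxOrder C := ⟨fun x => by
    obtain ⟨g, hg⟩ := hax x.1
    have hg' : x.1 < g⁻¹ • x.1 := smul_lt_iff.1 hg
    exact ⟨⟨g⁻¹ • x.1, hsmul x.2 (Or.inr hg'.le)⟩, hg'⟩⟩
  have _ : Nonempty C := ⟨⟨a, Coaxial.refl a⟩⟩
  let _ : SuccOrder C := LinearLocallyFiniteOrder.succOrder C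
  let _ : PredOrder C := LinearLocallyFiniteOrder.predOrder C
  let P : C ≃o ℤ := orderIsoIntOfLinearSuccPredArch
  refine ⟨fun x => if hx : Coaxial G a x then P ⟨x, hx⟩ else 0, fun x y hx hy => ?_, fun n => ?_⟩
  · simp only [hx, hy, dif_pos, P.lt_iff_lt]
    rfl
  · refine ⟨(P.symm n).1, (P.symm n).2, ?_⟩
    simp [(P.symm n).2]

/-- With `p` an integer coordinate on the class of `a`, the height is `2 * p - m`, extended oddly to
the reversed edges. The shift `m` puts the centre of the reflection `r` at zero, so that `r`
preserves heights. The centre is a vertex, as no edge is inverted; therefore `m` and all heights are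
odd. -/
theorem exists_lineHeight (hax : ∀ a : A, ∃ g : G, g • a < a) {a : A}
    (hline : ∀ x, Coaxial G a x ∨ Coaxial G a (-x)) (r : G) :
    ∃ h : A → ℤ, (∀ x, h (-x) = -h x) ∧ (∀ {x y}, Coaxial G x y → x < y → h x < h y) ∧
      (∀ x, Odd (h x)) ∧ (∀ n, Odd n → ∃ x, Coaxial G a x ∧ h x = n) ∧
      (∀ (g : G) x, Coaxial G a (g • a) → Coaxial G a x →
        h (g • x) = h x + 2 * translationNumber a g) ∧
      (¬ Coaxial G a (r • a) → ∀ x, Coaxial G a x → h (r • x) = h x) := by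
  classical
  obtain ⟨p, hlt, hsurj⟩ := exists_coordinate hax hline
  choose q hq hpq using hsurj
  have hinj : ∀ {x y}, Coaxial G a x → Coaxial G a y → p x = p y → x = y := by
    intro x y hx hy hxy
    by_contra hne
    rcases (hx.symm.trans hy).le_or_le hax with h | h
    · exact ((hlt x y hx hy).2 (lt_of_le_of_ne h hne)).ne hxy
    · exact ((hlt y x hy hx).2 (lt_of_le_of_ne h (Ne.symm hne))).ne hxy.symm
  have hqp : ∀ {x}, Coaxial G a x → q (p x) = x := fun {x} hx => hinj (hq _) hx (hpq _)
  have hqmono : StrictMono q := fun m n hmn => by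
    rw [← hlt _ _ (hq m) (hq n), hpq, hpq]; exact hmn
  have hcl : ∀ {g : G} {x}, Coaxial G a (g • a) → Coaxial G a x → Coaxial G a (g • x) :=
    fun {g x} hg hx => hg.trans (hx.smul g)
  have hinv : ∀ {g : G}, Coaxial G a (g • a) → Coaxial G a (g⁻¹ • a) := fun {g} hg => by
    simpa using (hg.smul g⁻¹).symm
  have htrans : ∀ {g : G}, Coaxial G a (g • a) →
      ∃ t, ∀ x, Coaxial G a x → p (g • x) = p x + t := by
    intro g hg
    refine ⟨p (g • q 0), fun x hx => ?_⟩
    have := Int.apply_eq_add_of_strictMono (f := fun n => p (g • q n)) ?_ ?_ (p x)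
    · simpa only [hqp hx] using this
    · intro m n hmn
      rw [hlt _ _ (hcl hg (hq m)) (hcl hg (hq n)), smul_lt_smul_iff]
      exact hqmono hmn
    · intro n
      refine ⟨p (g⁻¹ • q n), ?_⟩
      simp only
      rw [hqp (hcl (hinv hg) (hq n)), smul_inv_smul, hpq]
  have htau : ∀ {g : G}, Coaxial G a (g • a) → ∀ x, Coaxial G a x →
      p (g • x) = p x + translationNumber a g := by
    intro g hg
    obtain ⟨t, ht⟩ := htrans hg
    suffices translationNumber a g = t by rwa [this]
    have hz : ∀ k : ℤ, Coaxial G a (g ^ k • a) ∧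
        ∀ x, Coaxial G a x → p (g ^ k • x) = p x + k * t := by
      intro k
      induction k using Int.induction_on with
      | zero => simpa using Coaxial.refl a
      | succ k ih =>
        have hc : Coaxial G a (g ^ ((k : ℤ) + 1) • a) := by
          rw [zpow_add_one, mul_smul]
          exact hcl ih.1 hg
        refine ⟨hc, fun x hx => ?_⟩
        rw [zpow_add_one, mul_smul, ih.2 _ (hcl hg hx), ht x hx]
        ring
      | pred k ih =>
        have hc : Coaxial G a (g ^ (-(k : ℤ) - 1) • a) := by
          rw [zpow_sub_one, mul_smul]
          exact hcl ih.1 (hinv hg)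
        refine ⟨hc, fun x hx => ?_⟩
        have h1 := ht _ (hcl (hinv hg) hx)
        rw [smul_inv_smul] at h1
        rw [zpow_sub_one, mul_smul, ih.2 _ (hcl (hinv hg) hx), h1]
        ring
    -- The orbits of a translation by `t` are the residues modulo `t`. For `t = 0` there are
    -- infinitely many, and `Nat.card` is then `0`, which is still correct.
    have hcard : Nat.card (Quotient (classOrbitSetoid a g)) = t.natAbs := by
      let φ : {x : A // Coaxial G a x} → ZMod t.natAbs := fun x => (p x.1 : ZMod t.natAbs)
      have hφ : Function.Surjective φ := by
        intro z
        obtain ⟨n, rfl⟩ := ZMod.intCast_surjective z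
        exact ⟨⟨q n, hq n⟩, by simp only [φ, hpq]⟩
      rw [← Nat.card_zmod t.natAbs, ← Nat.card_congr (Setoid.quotientKerEquivOfSurjective φ hφ)]
      refine Nat.card_congr (Quotient.congr (Equiv.refl _) fun x y => ?_)
      change (∃ k : ℤ, g ^ k • x.1 = y.1) ↔ (p x.1 : ZMod t.natAbs) = p y.1
      rw [ZMod.intCast_eq_intCast_iff_dvd_sub, Int.natAbs_dvd]
      constructor
      · rintro ⟨k, hk⟩
        rw [← hk, (hz k).2 _ x.2]
        exact ⟨k, by ring⟩
      · rintro ⟨k, hk⟩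
        refine ⟨k, hinj (hcl (hz k).1 x.2) y.2 ?_⟩
        rw [(hz k).2 _ x.2]
        linarith
    rw [translationNumber, hcard]
    have hsign : g • a < a ↔ t < 0 := by
      rw [← hlt _ _ hg (Coaxial.refl a), ht a (Coaxial.refl a)]
      constructor <;> intro <;> linarith
    split_ifs with hneg
    · have := hsign.1 hneg
      omega
    · have := mt hsign.2 hneg
      omega
  have hrefl : ∃ m : ℤ, Odd m ∧ (¬ Coaxial G a (r • a) →
      ∀ x, Coaxial G a x → Coaxial G a (-(r • x)) ∧ p (-(r • x)) = m - p x) := by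
    by_cases hra : Coaxial G a (r • a)
    -- Without a reflection there is no centre to respect, and any odd `m` would do.
    · exact ⟨1, odd_one, fun h => absurd hra h⟩
    have hra' : Coaxial G a (-(r • a)) := (hline _).resolve_left hra
    have hcr : ∀ {x}, Coaxial G a x → Coaxial G a (-(r • x)) := fun {x} hx =>
      hra'.trans (hx.smul r).neg
    have hcr' : ∀ {x}, Coaxial G a x → Coaxial G a (-(r⁻¹ • x)) := by
      intro x hx
      have := (hra'.smul r⁻¹).neg
      rw [smul_neg_eq, inv_smul_smul, neg_neg] at this
      exact this.symm.trans (hx.smul r⁻¹).neg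
    have hform : ∀ x, Coaxial G a x → p (-(r • x)) = p (-(r • q 0)) - p x := by
      intro x hx
      have := Int.apply_eq_add_of_strictMono (f := fun n => -p (-(r • q n))) ?_ ?_ (p x)
      · simp only [hqp hx] at this
        linarith
      · intro m n hmn
        simp only
        rw [_root_.neg_lt_neg_iff, hlt _ _ (hcr (hq n)) (hcr (hq m)), neg_lt_neg_iff_lt,
          smul_lt_smul_iff]
        exact hqmono hmn
      · intro n
        refine ⟨p (-(r⁻¹ • q (-n))), ?_⟩
        simp only
        rw [hqp (hcr' (hq _)), smul_neg_eq, smul_inv_smul, neg_neg, hpq, neg_neg]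
    refine ⟨p (-(r • q 0)), ?_, fun _ x hx => ⟨hcr hx, hform x hx⟩⟩
    -- If `m = k + k`, then `r` inverts the edge with coordinate `k`.
    by_contra hodd
    rw [Int.not_odd_iff_even] at hodd
    obtain ⟨k, hk⟩ := hodd
    have h1 := hform _ (hq k)
    rw [hpq, hk, add_sub_cancel_right] at h1
    have h2 := hinj (hcr (hq k)) (hq k) (by rw [h1, hpq])
    exact smul_ne_neg r (q k) (by rw [← neg_neg (r • q k), h2])
  obtain ⟨m, hm, hrm⟩ := hrefl
  have hnot : ∀ {x}, Coaxial G a x → ¬ Coaxial G a (-x) := fun {x} hx hx' =>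
    (hx.symm.trans hx').not_coaxial_neg hax (by rw [neg_neg]; exact Coaxial.refl x)
  set h : A → ℤ := fun x => if Coaxial G a x then 2 * p x - m else -(2 * p (-x) - m) with hdef
  have h1 : ∀ {x}, Coaxial G a x → h x = 2 * p x - m := fun {x} hx => if_pos hx
  have hneg : ∀ x, h (-x) = -h x := by
    intro x
    rcases hline x with hx | hx
    · rw [h1 hx, hdef]
      simp only [hnot hx, if_false, neg_neg]
    · have : ¬ Coaxial G a x := fun hx' => hnot hx' hx
      rw [h1 hx, hdef]
      simp only [this, if_false, neg_neg]
  refine ⟨h, hneg, ?_, ?_, ?_, ?_, ?_⟩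
  · have mono : ∀ {x y}, Coaxial G a x → Coaxial G x y → x < y → h x < h y := by
      intro x y hx hxy hlt'
      rw [h1 hx, h1 (hx.trans hxy)]
      have := (hlt x y hx (hx.trans hxy)).2 hlt'
      linarith
    intro x y hxy hlt'
    rcases hline x with hx | hx
    · exact mono hx hxy hlt'
    · have := mono (hx.trans hxy.neg) hxy.neg.symm (neg_lt_neg_iff_lt.2 hlt')
      rw [hneg, hneg] at this
      linarith
  · intro x
    have odd1 : ∀ {x}, Coaxial G a x → Odd (h x) := fun {x} hx => by
      rw [h1 hx]
      exact (even_two_mul _).sub_odd hm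
    rcases hline x with hx | hx
    · exact odd1 hx
    · have := odd1 hx
      rw [hneg] at this
      simpa using this.neg
  · intro n hn
    obtain ⟨k, hk⟩ := hn.add_odd hm
    refine ⟨q k, hq k, ?_⟩
    rw [h1 (hq k), hpq]
    linarith
  · intro g x hg hx
    rw [h1 (hcl hg hx), h1 hx, htau hg x hx]
    ring
  · intro hra x hx
    obtain ⟨h2, h3⟩ := hrm hra x hx
    have h4 : h (r • x) = - h (-(r • x)) := by rw [hneg, neg_neg]
    rw [h4, h1 h2, h1 hx, h3]
    ring

/-- The same `r` normalizes both heights. Elements preserving the direction of the line add twice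
their translation number, which is the same for both trees; every other element is `r` times such an
element. -/
theorem AgreesOnOrbits.exists_orderIso_of_line (h : AgreesOnOrbits G Θ)
    (hax : ∀ a : A, ∃ g : G, g • a < a) {a : A}
    (hline : ∀ x, Coaxial G a x ∨ Coaxial G a (-x)) :
    ∃ F : A ≃o B, (∀ (g : G) a, F (g • a) = g • F a) ∧ ∀ a, F (-a) = -F a := by
  obtain ⟨r, hr⟩ : ∃ r : G, (∀ g : G, Coaxial G a (g • a)) ∨ ¬ Coaxial G a (r • a) := by
    by_cases hall : ∀ g : G, Coaxial G a (g • a)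
    · exact ⟨1, Or.inl hall⟩
    · push Not at hall
      obtain ⟨r, hr⟩ := hall
      exact ⟨r, Or.inr hr⟩
  have hiff : ∀ g : G, Coaxial G (Θ a) (g • Θ a) ↔ Coaxial G a (g • a) := fun g => by
    rw [← h.map_smul, h.coaxial_iff]
  have hlineB : ∀ y, Coaxial G (Θ a) y ∨ Coaxial G (Θ a) (-y) := by
    intro y
    have := hline (Θ.symm y)
    rwa [← h.coaxial_iff, ← h.coaxial_iff (e := a), h.map_neg, Θ.apply_symm_apply] at this
  obtain ⟨hA, negA, monoA, oddA, surjA, smulA, reflA⟩ := exists_lineHeight hax hline r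
  obtain ⟨hB, negB, monoB, oddB, surjB, smulB, reflB⟩ :=
    exists_lineHeight (h.exists_smul_lt hax) hlineB r
  refine h.exists_orderIso hax hA hB monoA monoB ?_ ?_ ?_ negA negB
  · intro e
    rcases hline e with he | he
    · obtain ⟨y, hy, hy'⟩ := surjB _ (oddA e)
      exact ⟨y, (h.coaxial_iff.2 he).symm.trans hy, hy'⟩
    · obtain ⟨y, hy, hy'⟩ := surjB _ (oddA (-e))
      refine ⟨-y, ?_, by rw [negB, hy', negA, neg_neg]⟩
      have := (h.coaxial_iff.2 he).symm.trans hy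
      rwa [h.map_neg, ← Coaxial.neg_iff, neg_neg] at this
  · intro y
    rcases hlineB y with hy | hy
    · obtain ⟨e, he, he'⟩ := surjA _ (oddB y)
      exact ⟨e, (h.coaxial_iff.2 he).symm.trans hy, he'.symm⟩
    · obtain ⟨e, he, he'⟩ := surjA _ (oddB (-y))
      refine ⟨-e, ?_, by rw [negA, he', negB, neg_neg]⟩
      have := (h.coaxial_iff.2 he).symm.trans hy
      rwa [h.map_neg, ← Coaxial.neg_iff, neg_neg]
  · have main : ∀ (g : G) {e y}, Coaxial G a e → Coaxial G (Θ e) y → hB y = hA e →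
        hB (g • y) = hA (g • e) := by
      intro g e y he hey heq
      have hy : Coaxial G (Θ a) y := (h.coaxial_iff.2 he).trans hey
      by_cases hg : Coaxial G a (g • a)
      · rw [smulA g e hg he, smulB g y ((hiff g).2 hg) hy, h.translationNumber_eq, heq]
      · have hra : ¬ Coaxial G a (r • a) := hr.resolve_left fun h => hg (h g)
        have hk : Coaxial G a ((r⁻¹ * g) • a) := by
          rw [mul_smul, ← Coaxial.smul_iff r, smul_inv_smul, ← Coaxial.neg_iff]
          exact ((hline _).resolve_left hra).symm.trans ((hline _).resolve_left hg)
        have e1 : g = r * (r⁻¹ * g) := by group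
        rw [e1, mul_smul, mul_smul r, reflA hra _ (hk.trans (he.smul _)),
          reflB (mt (hiff r).1 hra) _ (((hiff _).2 hk).trans (hy.smul _)),
          smulA _ e hk he, smulB _ y ((hiff _).2 hk) hy, h.translationNumber_eq, heq]
    intro g e y hey heq
    rcases hline e with he | he
    · exact main g he hey heq
    · have := main g (y := -y) he (by rw [h.map_neg]; exact hey.neg) (by rw [negA, negB, heq])
      rw [smul_neg_eq, smul_neg_eq, negA, negB] at this
      linarith

/-- An equivariant bijection between cofinite tree pocsets which preserves the order inside each
orbit of unoriented edges can be replaced by an equivariant order isomorphism. -/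
theorem AgreesOnOrbits.exists_equivariant_orderIso (h : AgreesOnOrbits G Θ)
    (hax : ∀ a : A, ∃ g : G, g • a < a)
    (hfin : ∃ s : Set A, s.Finite ∧ ∀ x : A, ∃ g : G, g • x ∈ s) :
    ∃ F : A ≃o B, (∀ (g : G) a, F (g • a) = g • F a) ∧ ∀ a, F (-a) = -F a := by
  -- Either no edge is moved within its own class, or one such motion forces the whole tree to be
  -- its axis.
  by_cases hfix : ∀ (a : A) (g : G), Coaxial G a (g • a) → g • a = a
  · exact h.exists_orderIso_of_finite hax (Coaxial.finite_of_smul_eq hfix hfin)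
  · push Not at hfix
    obtain ⟨a, g, hag, hne⟩ := hfix
    refine h.exists_orderIso_of_line hax (a := a) ?_
    rcases hag.le_or_le hax with h1 | h1
    · have h2 : g⁻¹ • a < a := by
        rw [smul_lt_iff, inv_inv]
        exact lt_of_le_of_ne h1 (Ne.symm hne)
      exact exists_line_of_smul_coaxial hax (by simpa using (hag.smul g⁻¹).symm) h2
    · exact exists_line_of_smul_coaxial hax hag (lt_of_le_of_ne h1 hne)

end Line

/-! ### Half-spaces of a tree -/

namespace SimpleGraph

variable {V : Type*} {G : SimpleGraph V}

/-- The half-space into which a dart points: the vertices that can be reached from its head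
without crossing its edge. -/
def Dart.halfSpace (d : G.Dart) : Set V :=
  {x | (G.deleteEdges {d.edge}).Reachable d.snd x}

theorem Dart.snd_mem_halfSpace (d : G.Dart) : d.snd ∈ d.halfSpace :=
  Reachable.refl _

theorem Dart.mem_halfSpace_of_adj {d : G.Dart} {x y : V} (hxy : G.Adj x y)
    (hne : s(x, y) ≠ d.edge) (hx : x ∈ d.halfSpace) : y ∈ d.halfSpace :=
  Reachable.trans hx (Adj.reachable (by simpa using ⟨hxy, hne⟩))

namespace IsTree

variable (h : G.IsTree) {d e : G.Dart} {x : V}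
include h

theorem not_reachable_deleteEdges (d : G.Dart) :
    ¬ (G.deleteEdges {d.edge}).Reachable d.fst d.snd :=
  isBridge_iff.1 (isAcyclic_iff_forall_isBridge.1 h.isAcyclic d.edge_mem)

theorem fst_notMem_halfSpace (d : G.Dart) : d.fst ∉ d.halfSpace := fun hd =>
  h.not_reachable_deleteEdges d hd.symm

theorem mem_halfSpace_symm_iff : x ∈ d.symm.halfSpace ↔ x ∉ d.halfSpace := by
  have hfst : d.fst ∈ d.symm.halfSpace := d.symm.snd_mem_halfSpace
  constructor
  · intro h1 h2
    refine h.not_reachable_deleteEdges d (Reachable.trans (v := x) ?_ (Reachable.symm h2))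
    have h3 : (G.deleteEdges {d.symm.edge}).Reachable d.symm.snd x := h1
    rwa [Dart.edge_symm] at h3
  · intro h1
    by_contra h2
    obtain ⟨p⟩ := h.connected.preconnected d.snd x
    obtain ⟨b, -, hb1, hb2⟩ := p.exists_boundary_dart (d.halfSpace ∪ d.symm.halfSpace)
      (Or.inl d.snd_mem_halfSpace) (by rintro (h | h) <;> contradiction)
    have hne : b.edge ≠ d.edge := by
      intro heq
      rcases (dart_edge_eq_iff _ _).1 heq with rfl | rfl
      · exact hb2 (Or.inl b.snd_mem_halfSpace)
      · exact hb2 (Or.inr hfst)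
    rcases hb1 with hb1 | hb1
    · exact hb2 (Or.inl (Dart.mem_halfSpace_of_adj b.adj hne hb1))
    · exact hb2 (Or.inr (Dart.mem_halfSpace_of_adj b.adj (by rwa [Dart.edge_symm]) hb1))

/-- The only dart entering the half-space of `d` is `d`. -/
theorem eq_of_fst_notMem_of_snd_mem (h1 : e.fst ∉ d.halfSpace) (h2 : e.snd ∈ d.halfSpace) :
    e = d := by
  by_contra hne
  have hedge : e.edge = d.edge := by
    by_contra hedge
    exact h1 (Dart.mem_halfSpace_of_adj e.adj.symm (by rwa [Sym2.eq_swap]) h2)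
  rcases (dart_edge_eq_iff _ _).1 hedge with rfl | rfl
  · exact hne rfl
  · exact h.fst_notMem_halfSpace d h2

theorem fst_mem_halfSpace_iff (hne : e ≠ d) (hne' : e ≠ d.symm) :
    e.fst ∈ d.halfSpace ↔ e.snd ∈ d.halfSpace := by
  constructor
  · intro h1
    by_contra h2
    refine hne' ?_
    rw [← h.eq_of_fst_notMem_of_snd_mem (e := e.symm) h2 h1, Dart.symm_symm]
  · intro h1
    by_contra h2
    exact hne (h.eq_of_fst_notMem_of_snd_mem h2 h1)

/-- A path from `d.fst` that leaves the union would have to leave along `d` or `e` backwards, but it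
then arrives at an origin, which lies in the other half-space. -/
theorem mem_halfSpace_or_mem_halfSpace (h1 : d.fst ∈ e.halfSpace) (h2 : e.fst ∈ d.halfSpace)
    (x : V) : x ∈ d.halfSpace ∨ x ∈ e.halfSpace := by
  by_contra hx
  obtain ⟨p⟩ := h.connected.preconnected d.fst x
  obtain ⟨c, -, hc1, hc2⟩ := p.exists_boundary_dart (d.halfSpace ∪ e.halfSpace) (Or.inr h1) hx
  rcases hc1 with hc1 | hc1
  · have := h.eq_of_fst_notMem_of_snd_mem (e := c.symm) (d := d) (fun h3 => hc2 (Or.inl h3)) hc1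
    rw [← this] at h1
    exact hc2 (Or.inr h1)
  · have := h.eq_of_fst_notMem_of_snd_mem (e := c.symm) (d := e) (fun h3 => hc2 (Or.inr h3)) hc1
    rw [← this] at h2
    exact hc2 (Or.inl h2)

theorem exists_dart_fst_eq_of_ne {u w : V} (hne : u ≠ w) :
    ∃ d : G.Dart, d.fst = u ∧ w ∈ d.halfSpace := by
  obtain ⟨p, hp⟩ := h.connected.preconnected.exists_isPath u w
  cases p with
  | nil => exact absurd rfl hne
  | cons hadj q =>
    rw [Walk.cons_isPath_iff] at hp
    refine ⟨⟨(_, _), hadj⟩, rfl, ?_⟩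
    rw [Dart.halfSpace, Set.mem_ofPred_eq]
    refine ⟨q.toDeleteEdges _ fun e he he' => hp.2 ?_⟩
    rw [Set.mem_singleton_iff] at he'
    subst he'
    exact q.fst_mem_support_of_mem_edges he

end IsTree

end SimpleGraph

/-! ### From trees to pocsets and back -/

namespace GGraph

open SimpleGraph TreePocset TreePocsetAction

variable {G : Type*} [Group G] {X : GGraph G} {Y : GGraph G}

/-- The oriented edges of a `G`-tree. -/
def OrientedEdge (_ : X.IsGTree) : Type _ := X.graph.Dart

namespace OrientedEdge

variable {h : X.IsGTree} {a b d e : OrientedEdge h} {x : X.V}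

/-- The origin of an oriented edge. -/
def src (a : OrientedEdge h) : X.V := (Dart.toProd a).1

/-- The end of an oriented edge. -/
def tgt (a : OrientedEdge h) : X.V := (Dart.toProd a).2

/-- The half-tree into which an oriented edge points. -/
def half (a : OrientedEdge h) : Set X.V := Dart.halfSpace a

theorem adj (a : OrientedEdge h) : X.graph.Adj a.src a.tgt := Dart.adj a

theorem ext (h1 : a.src = b.src) (h2 : a.tgt = b.tgt) : a = b :=
  Dart.ext _ _ (Prod.ext h1 h2)

theorem exists_eq {x y : X.V} (hxy : X.graph.Adj x y) :
    ∃ a : OrientedEdge h, a.src = x ∧ a.tgt = y := ⟨⟨(x, y), hxy⟩, rfl, rfl⟩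

instance : InvolutiveNeg (OrientedEdge h) where
  neg a := Dart.symm a
  neg_neg a := Dart.symm_symm a

instance : MulAction G (OrientedEdge h) where
  smul g a := ⟨(g • a.src, g • a.tgt), X.smul_adj g a.adj⟩
  one_smul a := ext (one_smul G a.src) (one_smul G a.tgt)
  mul_smul g k a := ext (mul_smul g k a.src) (mul_smul g k a.tgt)

@[simp] theorem src_neg (a : OrientedEdge h) : (-a).src = a.tgt := rfl

@[simp] theorem tgt_neg (a : OrientedEdge h) : (-a).tgt = a.src := rfl

@[simp] theorem src_smul (g : G) (a : OrientedEdge h) : (g • a).src = g • a.src := rfl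

@[simp] theorem tgt_smul (g : G) (a : OrientedEdge h) : (g • a).tgt = g • a.tgt := rfl

theorem tgt_mem_half (a : OrientedEdge h) : a.tgt ∈ a.half := Dart.snd_mem_halfSpace a

theorem src_notMem_half (a : OrientedEdge h) : a.src ∉ a.half :=
  h.isTree.fst_notMem_halfSpace a

theorem mem_half_neg : x ∈ (-a).half ↔ x ∉ a.half :=
  h.isTree.mem_halfSpace_symm_iff

theorem eq_of_crossing (h1 : e.src ∉ d.half) (h2 : e.tgt ∈ d.half) : e = d :=
  h.isTree.eq_of_fst_notMem_of_snd_mem h1 h2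

instance : PartialOrder (OrientedEdge h) where
  le a b := a.half ⊆ b.half
  le_refl a := subset_rfl
  le_trans a b c := Set.Subset.trans
  le_antisymm a b h1 h2 := eq_of_crossing (fun h3 => a.src_notMem_half (h2 h3))
    (h1 a.tgt_mem_half)

theorem neg_le_neg_of_le (hab : a ≤ b) : -b ≤ -a := fun x hx => by
  rw [mem_half_neg] at hx ⊢
  exact fun hx' => hx (hab hx')

theorem neg_le_of_mem (h1 : a.src ∈ b.half) (h2 : b.src ∈ a.half) : -a ≤ b := fun x hx =>
  (h.isTree.mem_halfSpace_or_mem_halfSpace h1 h2 x).resolve_left (mem_half_neg.1 hx)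

instance : TreePocset (OrientedEdge h) where
  neg_le_neg := neg_le_neg_of_le
  not_le_neg {a b} h1 h2 := mem_half_neg.1 (h2 a.tgt_mem_half) (h1 a.tgt_mem_half)
  nested a b := by
    by_cases hab : a = b
    · exact Or.inl hab.le
    by_cases hab' : a = -b
    · exact Or.inr (Or.inl hab'.le)
    have hba' : b ≠ -a := fun h1 => hab' (by rw [h1, neg_neg])
    have ha := h.isTree.fst_mem_halfSpace_iff (e := a) (d := b) hab hab'
    have hb := h.isTree.fst_mem_halfSpace_iff (e := b) (d := a) (Ne.symm hab) hba'
    by_cases h1 : a.src ∈ b.half <;> by_cases h2 : b.src ∈ a.half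
    · exact Or.inr (Or.inr (Or.inl (neg_le_of_mem h1 h2)))
    · refine Or.inl ?_
      rw [← neg_neg a]
      exact neg_le_of_mem (ha.1 h1) (mem_half_neg.2 h2)
    · refine Or.inr (Or.inr (Or.inr ?_))
      have := neg_le_of_mem (a := a) (b := -b) (mem_half_neg.2 h1) (hb.1 h2)
      simpa using neg_le_neg_of_le this
    · refine Or.inr (Or.inl ?_)
      rw [← neg_neg a]
      exact neg_le_of_mem (mem_half_neg.2 (mt ha.2 h1)) (mem_half_neg.2 (mt hb.2 h2))
  -- An edge in the interval separates `b.src` from `a.tgt`, so it occurs on any fixed walk between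
  -- them.
  finite_Icc a b := by
    obtain ⟨p⟩ := h.isTree.connected.preconnected b.src a.tgt
    refine p.darts.finite_toSet.subset fun c hc => ?_
    obtain ⟨d, hd, hd1, hd2⟩ := p.exists_boundary_dart (half c)ᶜ
      (fun h1 => b.src_notMem_half (hc.2 h1)) (fun h1 => h1 (hc.1 a.tgt_mem_half))
    have : d = c := eq_of_crossing (e := d) (d := c) hd1 (not_not.1 hd2)
    exact this ▸ hd

theorem smul_mem_half (g : G) (hx : x ∈ a.half) : g • x ∈ (g • a).half := by
  let φ : X.graph.deleteEdges {Dart.edge a} →g X.graph.deleteEdges {Dart.edge (g • a)} :=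
    { toFun := fun y => g • y
      map_rel' := by
        intro y z hyz
        rw [deleteEdges_adj] at hyz ⊢
        refine ⟨X.smul_adj g hyz.1, fun heq => hyz.2 ?_⟩
        have hinj := Sym2.map.injective (MulAction.injective (β := X.V) g)
        exact hinj (a₁ := s(y, z)) (a₂ := s(a.src, a.tgt)) heq }
  exact Reachable.map φ hx

theorem smul_mem_half_iff (g : G) : g • x ∈ (g • a).half ↔ x ∈ a.half :=
  ⟨fun hx => by simpa using smul_mem_half g⁻¹ hx, smul_mem_half g⟩

instance : TreePocsetAction G (OrientedEdge h) where
  smul_le_smul g a b hab x hx := by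
    rw [← smul_inv_smul g x, smul_mem_half_iff] at hx ⊢
    exact hab hx
  smul_neg_eq g a := rfl
  smul_ne_neg g a heq := h.no_inversion g a.src a.tgt a.adj
    ⟨congrArg src heq, congrArg tgt heq⟩

theorem le_neg_of_src_eq (hde : d.src = e.src) (hne : d ≠ e) : d ≤ -e := by
  have h1 : d.tgt ∉ e.half := fun h1 =>
    hne (eq_of_crossing (by rw [hde]; exact e.src_notMem_half) h1)
  have h2 : e.tgt ∉ d.half := fun h2 =>
    hne (eq_of_crossing (by rw [← hde]; exact d.src_notMem_half) h2).symm
  rcases nested d e with h3 | h3 | h3 | h3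
  · exact absurd (h3 d.tgt_mem_half) h1
  · exact h3
  · refine absurd (h3 (mem_half_neg.2 d.src_notMem_half)) ?_
    rw [hde]
    exact e.src_notMem_half
  · exact absurd (h3 e.tgt_mem_half) h2

theorem covBy_neg_of_src_eq (hde : d.src = e.src) (hne : d ≠ e) : d ⋖ -e := by
  refine ⟨lt_of_le_of_ne (le_neg_of_src_eq hde hne) ?_, fun x h1 h2 => ?_⟩
  · rintro rfl
    exact e.adj.ne hde.symm
  by_cases hx : d.src ∈ x.half
  · refine h2.ne' (eq_of_crossing ?_ ?_)
    · have := TreePocset.le_neg_comm.1 h2.le e.tgt_mem_half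
      exact mem_half_neg.1 this
    · rw [tgt_neg, ← hde]
      exact hx
  · exact h1.ne (eq_of_crossing hx (h1.le d.tgt_mem_half))

/-- If the origins differ, the first edge `y` on the way from `d.src` to `e.src` gives `d < -y <
-e`. -/
theorem src_eq_of_covBy_neg (hde : d ⋖ -e) : d.src = e.src := by
  by_contra hne
  obtain ⟨y, hy1, hy2⟩ := h.isTree.exists_dart_fst_eq_of_ne hne
  change OrientedEdge h at y
  replace hy1 : y.src = d.src := hy1
  replace hy2 : e.src ∈ y.half := hy2
  have hed : e ≤ -d := TreePocset.le_neg_comm.1 hde.le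
  have hdy : d ≠ y := by
    rintro rfl
    refine hde.lt.ne' (eq_of_crossing (mem_half_neg.1 (hed e.tgt_mem_half)) ?_)
    exact hy2
  have h1 : d < -y := by
    refine lt_of_le_of_ne (le_neg_of_src_eq hy1.symm hdy) ?_
    rintro rfl
    exact y.adj.ne hy1
  refine hde.2 h1 (lt_of_le_of_ne ?_ ?_)
  · have h2 : e.src ∉ (-y).half := fun h2 => mem_half_neg.1 h2 hy2
    have h3 : e.tgt ∉ (-y).half := fun h3 => by
      have := eq_of_crossing h2 h3
      rw [← this] at h1
      exact TreePocset.not_le_neg h1.le hde.le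
    rcases nested (-y) e with h4 | h4 | h4 | h4
    · exact absurd hde.le (TreePocset.not_le_neg (h1.le.trans h4))
    · exact h4
    · rw [neg_neg] at h4
      exact absurd (h4 hy2) e.src_notMem_half
    · exact absurd (h4 e.tgt_mem_half) h3
  · intro heq
    rw [neg_inj] at heq
    exact hne (by rw [← hy1, heq])

/-- This expresses vertices through the order alone: a vertex is a class of oriented edges with
common origin. -/
theorem src_eq_iff : d.src = e.src ↔ d = e ∨ d ⋖ -e := by
  constructor
  · intro hde
    by_cases hne : d = e
    · exact Or.inl hne
    · exact Or.inr (covBy_neg_of_src_eq hde hne)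
  · rintro (rfl | hde)
    exacts [rfl, src_eq_of_covBy_neg hde]

theorem exists_src_eq [Nonempty (OrientedEdge h)] (v : X.V) :
    ∃ d : OrientedEdge h, d.src = v := by
  obtain ⟨a⟩ := ‹Nonempty (OrientedEdge h)›
  by_cases hv : v = a.src
  · exact ⟨a, hv.symm⟩
  · obtain ⟨d, hd, -⟩ := h.isTree.exists_dart_fst_eq_of_ne hv
    exact ⟨d, hd⟩

/-- A `G`-tree with at least one edge is determined by its ordered set of oriented edges. -/
theorem isIsomorphic_of_orderIso {h' : Y.IsGTree} [Nonempty (OrientedEdge h)]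
    (F : OrientedEdge h ≃o OrientedEdge h') (hsmul : ∀ (g : G) a, F (g • a) = g • F a)
    (hneg : ∀ a, F (-a) = -F a) : X.IsIsomorphic Y := by
  have : Nonempty (OrientedEdge h') := ‹Nonempty (OrientedEdge h)›.map F
  have hsrc : ∀ {d e}, (F d).src = (F e).src ↔ d.src = e.src := by
    intro d e
    rw [src_eq_iff, src_eq_iff, F.injective.eq_iff, ← hneg, apply_covBy_apply_iff]
  -- A vertex `v` goes to the origin of `F (D v)`; by `hsrc` the choice of the outgoing edge `D v`
  -- does not matter.
  choose D hD using exists_src_eq (h := h)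
  have hφ : ∀ d, (F (D d.src)).src = (F d).src := fun d => hsrc.2 (hD _)
  have hbij : Function.Bijective fun v => (F (D v)).src := by
    constructor
    · intro v w hvw
      rw [← hD v, ← hD w]
      exact hsrc.1 hvw
    · intro w
      obtain ⟨d', rfl⟩ := exists_src_eq (h := h') w
      obtain ⟨d, rfl⟩ := F.surjective d'
      exact ⟨d.src, hφ d⟩
  refine ⟨⟨Equiv.ofBijective _ hbij, fun {v w} => ?_⟩, fun g v => ?_⟩
  · change Y.graph.Adj (F (D v)).src (F (D w)).src ↔ X.graph.Adj v w
    constructor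
    · intro hvw
      obtain ⟨d', h1, h2⟩ := exists_eq (h := h') hvw
      obtain ⟨d, rfl⟩ := F.surjective d'
      rw [← src_neg, ← hneg] at h2
      rw [hsrc, hD] at h1 h2
      rw [← h1, ← h2]
      exact d.adj
    · intro hvw
      obtain ⟨d, rfl, rfl⟩ := exists_eq (h := h) hvw
      have := hφ (-d)
      rw [src_neg, hneg, src_neg] at this
      rw [hφ, this]
      exact (F d).adj
  · change (F (D (g • v))).src = g • (F (D v)).src
    rw [← src_smul, ← hsmul, hsrc, hD, src_smul, hD]

/-- An edge strictly between `g • e` and `-e` would be a translate of `e` up to orientation, giving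
two strictly comparable translates. So `-e` covers `g • e` unless `g • e = e`, and the origins
agree. -/
theorem fixed_of_forall_le_neg (horb : ∀ e f : OrientedEdge h, ∃ g : G, g • e = f ∨ g • e = -f)
    (hlt : ∀ g : G, ¬ g • e < e) (hle : ∀ g : G, g • e = e ∨ g • e ≤ -e) (g : G) :
    g • e.src = e.src := by
  have hlt' : ∀ g k : G, ¬ g • e < k • e := fun g k hgk => by
    rw [lt_smul_iff, ← mul_smul] at hgk
    exact hlt _ hgk
  rw [← src_smul, src_eq_iff]
  refine (hle g).imp_right fun h1 => ⟨lt_of_le_of_ne h1 (smul_ne_neg g e), fun x h2 h3 => ?_⟩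
  obtain ⟨k, hk | hk⟩ := horb e x
  · rw [← hk] at h2
    exact hlt' g k h2
  · have h4 := lt_neg_comm.1 h3
    rw [← hk] at h4
    exact hlt' 1 k (by rwa [one_smul])

/-- If there is only one orbit of edges and no fixed vertex, then each edge lies on an axis. -/
theorem exists_smul_lt (horb : ∀ e f : OrientedEdge h, ∃ g : G, g • e = f ∨ g • e = -f)
    (hfix : ¬ ∃ v : X.V, ∀ g : G, g • v = v) (e : OrientedEdge h) : ∃ g : G, g • e < e := by
  by_contra! hlt
  have hle : ∀ g : G, g • e ≤ e → g • e = e := fun g hg => by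
    by_contra hne
    exact hlt g (lt_of_le_of_ne hg hne)
  have hge : ∀ g : G, e ≤ g • e → g • e = e := fun g hg => by
    rw [le_smul_iff] at hg
    have := hle _ hg
    rw [inv_smul_eq_iff] at this
    exact this.symm
  -- If some translate of `e` lies behind the origin of `e`, that origin is fixed; otherwise the
  -- other endpoint is.
  by_cases hcase : ∃ g : G, g • e ≤ -e
  · obtain ⟨g, hg⟩ := hcase
    refine hfix ⟨e.src, fixed_of_forall_le_neg horb hlt fun k => ?_⟩
    rcases nested (k • e) e with h1 | h1 | h1 | h1
    · exact Or.inl (hle k h1)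
    · exact Or.inr h1
    · exfalso
      rw [TreePocset.neg_le_comm] at h1
      have h2 := hg.trans h1
      rw [le_smul_iff, ← mul_smul] at h2
      have h3 := hle _ h2
      rw [mul_smul, inv_smul_eq_iff] at h3
      rw [← h3] at h1
      exact smul_ne_neg g e (le_antisymm hg h1)
    · exact Or.inl (hge k h1)
  · push Not at hcase
    refine hfix ⟨(-e).src, fixed_of_forall_le_neg (fun e f => ?_) (fun g hg => ?_) fun k => ?_⟩
    · exact horb e f
    · rw [smul_neg_eq, neg_lt_neg_iff_lt, lt_smul_iff] at hg
      exact hlt _ hg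
    · rw [smul_neg_eq, neg_inj, neg_neg]
      rcases nested (k • e) e with h1 | h1 | h1 | h1
      · exact Or.inl (hle k h1)
      · exact absurd h1 (hcase k)
      · exact Or.inr h1
      · exact Or.inl (hge k h1)

end OrientedEdge

end GGraph

/-! ### Collapse maps and the edges of a compatibility tree -/

namespace GGraph

open SimpleGraph TreePocset TreePocsetAction OrientedEdge

variable {G : Type*} [Group G]

/-- A `G`-equivariant map which collapses all edges outside the set `O`. -/
structure IsCollapseMap {X : GGraph G} {S : GGraph G} (O : Set (Sym2 X.V)) (π : X.V → S.V) :
    Prop where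
  surjective : Function.Surjective π
  map_smul : ∀ (g : G) v, π (g • v) = g • π v
  eq_of_notMem : ∀ {a b}, X.graph.Adj a b → s(a, b) ∉ O → π a = π b
  adj : ∀ {a b}, X.graph.Adj a b → s(a, b) ∈ O → S.graph.Adj (π a) (π b)
  exists_adj : ∀ {x y}, S.graph.Adj x y →
    ∃ a b, X.graph.Adj a b ∧ s(a, b) ∈ O ∧ π a = x ∧ π b = y
  unique : ∀ {a b a' b'}, X.graph.Adj a b → s(a, b) ∈ O → X.graph.Adj a' b' → s(a', b') ∈ O →
    π a = π a' → π b = π b' → a = a' ∧ b = b'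
  smul_mem : ∀ (g : G) {a b}, s(a, b) ∈ O → s(g • a, g • b) ∈ O

/-- Everything rests on edges of a tree being bridges: a second edge of `O` between the same two
components, or a path within one component joining the ends of an edge of `O`, would bypass such an
edge. -/
theorem exists_isCollapseMap {X : GGraph G} {S : GGraph G} (h : X.IsGTree) (O : X.edgeOrbits)
    (hS : (X.collapseAllExcept O).IsIsomorphic S) :
    ∃ π : X.V → S.V, IsCollapseMap O.1 π := by
  obtain ⟨f, hf⟩ := hS
  let κ : X.V → (X.collapseAllExcept O).V := (X.collapsed O).connectedComponentMk
  have hκ : ∀ {a b}, κ a = κ b ↔ (X.collapsed O).Reachable a b := ConnectedComponent.eq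
  have hbridge : ∀ {a b}, X.graph.Adj a b → s(a, b) ∈ O.1 →
      ¬ (X.graph.deleteEdges {s(a, b)}).Reachable a b := fun {a b} hab _ =>
    h.isTree.not_reachable_deleteEdges ⟨(a, b), hab⟩
  have hmono : ∀ {e}, e ∈ O.1 → X.collapsed O ≤ X.graph.deleteEdges {e} := fun {e} he =>
    deleteEdges_anti (Set.singleton_subset_iff.2 he)
  have hne : ∀ {a b}, X.graph.Adj a b → s(a, b) ∈ O.1 → κ a ≠ κ b := fun {a b} hab hO heq =>
    hbridge hab hO ((hκ.1 heq).mono (hmono hO))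
  refine ⟨fun v => f (κ v), ?_, ?_, ?_, ?_, ?_, ?_, ?_⟩
  · refine f.surjective.comp fun C => ?_
    induction C using ConnectedComponent.ind with
    | h v => exact ⟨v, rfl⟩
  · intro g v
    rw [← hf]
    rfl
  · intro a b hab hO
    refine congrArg f (hκ.2 (Adj.reachable ?_))
    exact deleteEdges_adj.2 ⟨hab, hO⟩
  · intro a b hab hO
    exact f.map_adj_iff.2 ⟨hne hab hO, a, b, hab, hO, rfl, rfl⟩
  · intro x y hxy
    obtain ⟨C, rfl⟩ := f.surjective x
    obtain ⟨D, rfl⟩ := f.surjective y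
    obtain ⟨-, a, b, hab, hO, rfl, rfl⟩ := f.map_adj_iff.1 hxy
    exact ⟨a, b, hab, hO, rfl, rfl⟩
  · intro a b a' b' hab hO hab' hO' ha hb
    have ha' := hκ.1 (f.injective ha)
    have hb' := hκ.1 (f.injective hb)
    by_cases heq : s(a', b') = s(a, b)
    · rcases Sym2.eq_iff.1 heq with ⟨rfl, rfl⟩ | ⟨rfl, rfl⟩
      · exact ⟨rfl, rfl⟩
      · exact absurd (f.injective ha) (hne hab hO)
    · refine absurd ?_ (hbridge hab hO)
      exact (ha'.mono (hmono hO)).trans (Reachable.trans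
        (Adj.reachable (deleteEdges_adj.2 ⟨hab', heq⟩)) (hb'.symm.mono (hmono hO)))
  · intro g a b hab
    refine X.moveEdge_mem O g⁻¹ ?_
    simpa [moveEdge] using hab

namespace IsCollapseMap

variable {X : GGraph G} {S : GGraph G} {O : Set (Sym2 X.V)} {π : X.V → S.V}
  {h : X.IsGTree} {hS : S.IsGTree}

theorem exists_lift (hπ : IsCollapseMap O π) (x : OrientedEdge hS) :
    ∃ a : OrientedEdge h, s(a.src, a.tgt) ∈ O ∧ π a.src = x.src ∧ π a.tgt = x.tgt := by
  obtain ⟨a, b, hab, hO, ha, hb⟩ := hπ.exists_adj x.adj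
  exact ⟨⟨(a, b), hab⟩, hO, ha, hb⟩

/-- The edge of `X` which is mapped to a given edge of `S`. -/
noncomputable def lift (hπ : IsCollapseMap O π) (h : X.IsGTree) (x : OrientedEdge hS) :
    OrientedEdge h :=
  (hπ.exists_lift x).choose

theorem lift_mem (hπ : IsCollapseMap O π) (x : OrientedEdge hS) :
    s((hπ.lift h x).src, (hπ.lift h x).tgt) ∈ O :=
  (hπ.exists_lift x).choose_spec.1

theorem map_src_lift (hπ : IsCollapseMap O π) (x : OrientedEdge hS) :
    π (hπ.lift h x).src = x.src :=
  (hπ.exists_lift x).choose_spec.2.1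

theorem map_tgt_lift (hπ : IsCollapseMap O π) (x : OrientedEdge hS) :
    π (hπ.lift h x).tgt = x.tgt :=
  (hπ.exists_lift x).choose_spec.2.2

theorem lift_eq (hπ : IsCollapseMap O π) {x : OrientedEdge hS} {a : OrientedEdge h}
    (ha : s(a.src, a.tgt) ∈ O) (h1 : π a.src = x.src) (h2 : π a.tgt = x.tgt) :
    hπ.lift h x = a := by
  have := hπ.unique (hπ.lift h x).adj (hπ.lift_mem x) a.adj ha
    (by rw [hπ.map_src_lift, h1]) (by rw [hπ.map_tgt_lift, h2])
  exact OrientedEdge.ext this.1 this.2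

theorem exists_lift_eq (hπ : IsCollapseMap O π) (hS : S.IsGTree) {a : OrientedEdge h}
    (ha : s(a.src, a.tgt) ∈ O) : ∃ x : OrientedEdge hS, hπ.lift h x = a :=
  ⟨⟨(π a.src, π a.tgt), hπ.adj a.adj ha⟩, hπ.lift_eq ha rfl rfl⟩

theorem lift_injective (hπ : IsCollapseMap O π) :
    Function.Injective (hπ.lift h : OrientedEdge hS → OrientedEdge h) := fun x y hxy =>
  OrientedEdge.ext (by rw [← hπ.map_src_lift (h := h), hxy, hπ.map_src_lift])
    (by rw [← hπ.map_tgt_lift (h := h), hxy, hπ.map_tgt_lift])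

theorem lift_smul (hπ : IsCollapseMap O π) (g : G) (x : OrientedEdge hS) :
    hπ.lift h (g • x) = g • hπ.lift h x := by
  refine hπ.lift_eq (hπ.smul_mem g (hπ.lift_mem x)) ?_ ?_
  · rw [src_smul, hπ.map_smul, hπ.map_src_lift, src_smul]
  · rw [tgt_smul, hπ.map_smul, hπ.map_tgt_lift, tgt_smul]

theorem lift_neg (hπ : IsCollapseMap O π) (x : OrientedEdge hS) :
    hπ.lift h (-x) = -hπ.lift h x := by
  refine hπ.lift_eq ?_ (hπ.map_tgt_lift x) (hπ.map_src_lift x)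
  rw [Sym2.eq_swap]
  exact hπ.lift_mem x

/-- The image of a path can leave `x.half` only across `-x`, and the only edge of `O` above it is
the reversed lift, which the path avoids. -/
theorem map_mem_half (hπ : IsCollapseMap O π) (x : OrientedEdge hS) {v : X.V}
    (hv : v ∈ (hπ.lift h x).half) : π v ∈ x.half := by
  by_contra hv'
  obtain ⟨p⟩ := hv
  obtain ⟨c, -, hc1, hc2⟩ := p.exists_boundary_dart {z | π z ∈ x.half}
    (by
      change π (hπ.lift h x).tgt ∈ x.half
      rw [hπ.map_tgt_lift]
      exact x.tgt_mem_half) hv'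
  obtain ⟨hadj, hne⟩ := deleteEdges_adj.1 c.adj
  by_cases hO : s(c.fst, c.snd) ∈ O
  · obtain ⟨y, hy1, hy2⟩ := OrientedEdge.exists_eq (h := hS) (hπ.adj hadj hO)
    have hyx : -y = x := eq_of_crossing (by rw [src_neg, hy2]; exact hc2)
      (by rw [tgt_neg, hy1]; exact hc1)
    have hxy : y = -x := by rw [← hyx, neg_neg]
    obtain ⟨d, hd1, hd2⟩ := OrientedEdge.exists_eq (h := h) hadj
    have hl : hπ.lift h (-x) = d := hπ.lift_eq (by rw [hd1, hd2]; exact hO)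
      ((congrArg π hd1).trans (hy1.symm.trans (congrArg src hxy)))
      ((congrArg π hd2).trans (hy2.symm.trans (congrArg tgt hxy)))
    rw [lift_neg] at hl
    refine hne (Set.mem_singleton_iff.2 ?_)
    refine Eq.trans ?_ (Sym2.eq_swap (a := (hπ.lift h x).tgt) (b := (hπ.lift h x).src))
    rw [← hd1, ← hd2, ← hl]
    rfl
  · have := hπ.eq_of_notMem hadj hO
    exact hc2 (show π c.snd ∈ x.half from this ▸ hc1)

theorem mem_half_lift_iff (hπ : IsCollapseMap O π) (x : OrientedEdge hS) {v : X.V} :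
    v ∈ (hπ.lift h x).half ↔ π v ∈ x.half := by
  refine ⟨hπ.map_mem_half x, fun hv => ?_⟩
  by_contra hv'
  rw [← mem_half_neg, ← lift_neg] at hv'
  exact mem_half_neg.1 (hπ.map_mem_half _ hv') hv

/-- The half-tree of a lift is the preimage of a half-tree under the surjection `π`, so inclusions
correspond. -/
theorem lift_le_lift_iff (hπ : IsCollapseMap O π) {x y : OrientedEdge hS} :
    hπ.lift h x ≤ hπ.lift h y ↔ x ≤ y := by
  constructor
  · intro hxy v hv
    obtain ⟨w, rfl⟩ := hπ.surjective v
    rw [← hπ.mem_half_lift_iff (h := h)] at hv ⊢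
    exact hxy hv
  · intro hxy v hv
    rw [hπ.mem_half_lift_iff] at hv ⊢
    exact hxy hv

end IsCollapseMap

theorem eq_of_mem_edgeOrbits {X : GGraph G} {O O' : Set (Sym2 X.V)} (hO : O ∈ X.edgeOrbits)
    (hO' : O' ∈ X.edgeOrbits) {e : Sym2 X.V} (he : e ∈ O) (he' : e ∈ O') : O = O' := by
  have key : ∀ {O}, O ∈ X.edgeOrbits → e ∈ O → O = {f | ∃ g : G, X.moveEdge g e = f} := by
    rintro _ ⟨e₀, -, rfl⟩ ⟨g, rfl⟩
    ext f
    constructor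
    · rintro ⟨k, rfl⟩
      exact ⟨k * g⁻¹, by rw [← moveEdge_mul, inv_mul_cancel_right]⟩
    · rintro ⟨k, rfl⟩
      exact ⟨k * g, by rw [moveEdge_mul]⟩
  rw [key hO he, key hO' he']

theorem exists_mem_edgeOrbits {X : GGraph G} {e : Sym2 X.V} (he : e ∈ X.graph.edgeSet) :
    ∃ O ∈ X.edgeOrbits, e ∈ O :=
  ⟨_, ⟨e, he, rfl⟩, 1, X.moveEdge_one e⟩

theorem exists_moveEdge_eq {X : GGraph G} {O : Set (Sym2 X.V)} (hO : O ∈ X.edgeOrbits)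
    {e f : Sym2 X.V} (he : e ∈ O) (hf : f ∈ O) : ∃ g : G, X.moveEdge g e = f := by
  obtain ⟨e₀, -, rfl⟩ := hO
  obtain ⟨g, rfl⟩ := he
  obtain ⟨k, rfl⟩ := hf
  exact ⟨k * g⁻¹, by rw [← moveEdge_mul, inv_mul_cancel_right]⟩

theorem OrientedEdge.eq_or_eq_neg {X : GGraph G} {h : X.IsGTree} {a b : OrientedEdge h}
    (hab : s(a.src, a.tgt) = s(b.src, b.tgt)) : a = b ∨ a = -b :=
  (dart_edge_eq_iff _ _).1 hab

theorem IsSplitting.exists_smul_lt {S : GGraph G} (hS : S.IsSplitting)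
    (x : OrientedEdge hS.isGTree) : ∃ g : G, g • x < x := by
  refine OrientedEdge.exists_smul_lt (fun e f => ?_) hS.no_fixed_point x
  obtain ⟨O, hO⟩ := hS.one_edge_orbit
  have hmem : ∀ a : OrientedEdge hS.isGTree, s(a.src, a.tgt) ∈ O := fun a => by
    obtain ⟨O', hO', ha⟩ := exists_mem_edgeOrbits (X := S) (e := s(a.src, a.tgt)) a.adj
    rw [hO, Set.mem_singleton_iff] at hO'
    exact hO' ▸ ha
  obtain ⟨g, hg⟩ := exists_moveEdge_eq (hO ▸ Set.mem_singleton O) (hmem e) (hmem f)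
  exact ⟨g, OrientedEdge.eq_or_eq_neg (a := g • e) (b := f) hg⟩

/-- The oriented edges of a compatibility tree are those of the trees of the family. -/
theorem IsCompatibilityTree.exists_equiv {J : Type*} {σ : J → GGraph G}
    (hσ : ∀ j, (σ j).IsGTree) {T : GGraph G} (hT : T.IsCompatibilityTree σ) :
    ∃ Φ : (Σ j, OrientedEdge (hσ j)) ≃ OrientedEdge hT.1,
      (∀ (g : G) j x, Φ ⟨j, g • x⟩ = g • Φ ⟨j, x⟩) ∧ (∀ j x, Φ ⟨j, -x⟩ = -Φ ⟨j, x⟩) ∧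
      ∀ j x y, Φ ⟨j, x⟩ ≤ Φ ⟨j, y⟩ ↔ x ≤ y := by
  obtain ⟨h, φ, hφ⟩ := hT
  choose π hπ using fun j => exists_isCollapseMap h (φ j) (hφ j)
  let Φ : (Σ j, OrientedEdge (hσ j)) → OrientedEdge h := fun p => (hπ p.1).lift h p.2
  have hΦ : Function.Bijective Φ := by
    constructor
    · rintro ⟨j, x⟩ ⟨k, y⟩ hxy
      replace hxy : (hπ j).lift h x = (hπ k).lift h y := hxy
      obtain rfl : j = k := by
        refine φ.injective (Subtype.ext (eq_of_mem_edgeOrbits (φ j).2 (φ k).2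
          ((hπ j).lift_mem (h := h) x) ?_))
        rw [hxy]
        exact (hπ k).lift_mem y
      rw [(hπ j).lift_injective hxy]
    · intro a
      obtain ⟨O, hO, ha⟩ := exists_mem_edgeOrbits (X := T) (e := s(a.src, a.tgt)) a.adj
      obtain ⟨j, hj⟩ := φ.surjective ⟨O, hO⟩
      have ha' : s(a.src, a.tgt) ∈ (φ j).1 := by rwa [hj]
      obtain ⟨x, hx⟩ := (hπ j).exists_lift_eq (hσ j) ha'
      exact ⟨⟨j, x⟩, hx⟩
  exact ⟨Equiv.ofBijective Φ hΦ, fun g j x => (hπ j).lift_smul g x,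
    fun j x => (hπ j).lift_neg x, fun j x y => (hπ j).lift_le_lift_iff⟩

theorem IsCompatibilityTree.exists_finite_set {J : Type*} [Finite J] {σ : J → GGraph G}
    {T : GGraph G} (hT : T.IsCompatibilityTree σ) :
    ∃ s : Set (OrientedEdge hT.1), s.Finite ∧ ∀ a, ∃ g : G, g • a ∈ s := by
  obtain ⟨h, φ, -⟩ := hT
  have hrep : ∀ j, ∃ e : OrientedEdge h, s(e.src, e.tgt) ∈ (φ j).1 := by
    intro j
    obtain ⟨e, he, hO⟩ := (φ j).2
    have he' : e ∈ (φ j).1 := by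
      rw [hO]
      exact ⟨1, T.moveEdge_one e⟩
    induction e with
    | h a b =>
      obtain ⟨d, rfl, rfl⟩ := OrientedEdge.exists_eq (h := h) he
      exact ⟨d, he'⟩
  choose e he using hrep
  refine ⟨Set.range e ∪ Set.range fun j => -e j,
    (Set.finite_range _).union (Set.finite_range _), fun a => ?_⟩
  obtain ⟨O, hO, ha⟩ := exists_mem_edgeOrbits (X := T) (e := s(a.src, a.tgt)) a.adj
  obtain ⟨j, hj⟩ := φ.surjective ⟨O, hO⟩
  obtain ⟨g, hg⟩ := exists_moveEdge_eq hO ha (by simpa only [hj] using he j)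
  rcases OrientedEdge.eq_or_eq_neg (a := g • a) (b := e j) hg with h1 | h1
  · exact ⟨g, Or.inl ⟨j, h1.symm⟩⟩
  · exact ⟨g, Or.inr ⟨j, h1.symm⟩⟩

theorem IsGTree.subsingleton {X : GGraph G} (h : X.IsGTree) [IsEmpty (OrientedEdge h)] :
    Subsingleton X.V := ⟨fun u w => by
  by_contra hne
  obtain ⟨d, -, -⟩ := h.isTree.exists_dart_fst_eq_of_ne hne
  exact isEmptyElim (show OrientedEdge h from d)⟩

theorem isIsomorphic_of_isEmpty {X : GGraph G} {Y : GGraph G} (h : X.IsGTree) (h' : Y.IsGTree)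
    [IsEmpty (OrientedEdge h)] [IsEmpty (OrientedEdge h')] : X.IsIsomorphic Y := by
  have := h.subsingleton
  have := h'.subsingleton
  obtain ⟨x⟩ := h.isTree.connected.nonempty
  obtain ⟨y⟩ := h'.isTree.connected.nonempty
  refine ⟨⟨⟨fun _ => y, fun _ => x, fun _ => Subsingleton.elim _ _,
    fun _ => Subsingleton.elim _ _⟩, fun {a b} => ?_⟩, fun g a => Subsingleton.elim _ _⟩
  exact iff_of_false (fun hab => hab.ne (Subsingleton.elim _ _))
    (fun hab => hab.ne (Subsingleton.elim _ _))

end GGraph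

theorem corollary5p7 {G : Type*} [Group G] {J : Type*} [Finite J]
    (σ : J → GGraph G) (hσ : ∀ j, (σ j).IsSplitting)
    (T T' : GGraph G)
    (hT : T.IsCompatibilityTree σ) (hT' : T'.IsCompatibilityTree σ) :
    T.IsIsomorphic T' := by
  obtain ⟨Φ, Φsmul, Φneg, Φle⟩ := hT.exists_equiv fun j => (hσ j).isGTree
  obtain ⟨Ψ, Ψsmul, Ψneg, Ψle⟩ := hT'.exists_equiv fun j => (hσ j).isGTree
  have hΘ : AgreesOnOrbits G (Φ.symm.trans Ψ) := by
    have key : ∀ {P : GGraph.OrientedEdge hT.1 → Prop}, (∀ j x, P (Φ ⟨j, x⟩)) → ∀ a, P a :=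
      fun {P} hP a => by
        obtain ⟨⟨j, x⟩, rfl⟩ := Φ.surjective a
        exact hP j x
    have Θ_apply : ∀ p, (Φ.symm.trans Ψ) (Φ p) = Ψ p := fun p => by simp
    constructor
    · refine fun g => key fun j x => ?_
      rw [← Φsmul, Θ_apply, Θ_apply, Ψsmul]
    · refine key fun j x => ?_
      rw [← Φneg, Θ_apply, Θ_apply, Ψneg]
    · refine fun g => key fun j x => ?_
      rw [Θ_apply, ← Φsmul, ← Ψsmul, Φle, Ψle]
    · refine fun g => key fun j x => ?_
      rw [Θ_apply, ← Φsmul, ← Ψsmul, ← Φneg, ← Ψneg, Φle, Ψle]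
    · refine fun g => key fun j x => ?_
      rw [Θ_apply, ← Φsmul, ← Ψsmul, ← Φneg, ← Ψneg, Φle, Ψle]
  have hax : ∀ a : GGraph.OrientedEdge hT.1, ∃ g : G, g • a < a := by
    intro a
    obtain ⟨⟨j, x⟩, rfl⟩ := Φ.surjective a
    obtain ⟨g, hg⟩ := (hσ j).exists_smul_lt x
    refine ⟨g, ?_⟩
    rwa [← Φsmul, lt_iff_le_not_ge, Φle, Φle, ← lt_iff_le_not_ge]
  -- Without edges, which happens for empty `J`, the order carries no information and both trees are
  -- single vertices.
  cases isEmpty_or_nonempty (GGraph.OrientedEdge hT.1)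
  · have : IsEmpty (GGraph.OrientedEdge hT'.1) := (Φ.symm.trans Ψ).symm.isEmpty
    exact GGraph.isIsomorphic_of_isEmpty hT.1 hT'.1
  · obtain ⟨F, Fsmul, Fneg⟩ := hΘ.exists_equivariant_orderIso hax hT.exists_finite_set
    exact GGraph.OrientedEdge.isIsomorphic_of_orderIso F Fsmul Fneg
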